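/- Let $k$ be a field of characteristic $0$, let $\Gamma$ be an abelian group and let $\epsilon:\Gamma\times\Gamma\to k^{*}$ be a commutation factor: $\epsilon(\alpha,\beta)\epsilon(\beta,\alpha)=1$, $\epsilon(\alpha,\beta+\gamma)=\epsilon(\alpha,\beta)\epsilon(\alpha,\gamma)$, $\epsilon(\alpha+\beta,\gamma)=\epsilon(\alpha,\gamma)\epsilon(\beta,\gamma)$. All vector spaces are over $k$, and formulas stated for homogeneous elements are extended linearly. **Algebras and modules.** A *generalized left-symmetric algebra* is a finite-dimensional $\Gamma$-graded space $S=\bigoplus_{\gamma}S_\gamma$ with a bilinear product satisfying $S_\alpha\cdot S_\beta\subseteq S_{\alpha+\beta}$ and $$(x\cdot y)\cdot z-x\cdot(y\cdot z)=\epsilon(\alpha,\beta)\bigl((y\cdot x)\cdot z-y\cdot(x\cdot z)\bigr),\qquad x\in S_\alpha,\ y\in S_\beta,\ z\in S .$$ An *$S$-bimodule* is a finite-dimensional $\Gamma$-graded space $M$ with bilinear actions $S\times M\to M$ and $M\times S\to M$ satisfying $S_\alpha\cdot M_\beta\subseteq M_{\alpha+\beta}$, $M_\alpha\cdot S_\beta\subseteq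 M_{\alpha+\beta}$ and, for $x\in S_\alpha$, $y\in S_\beta$, $m\in M_\gamma$, $$(x\cdot y)\cdot m-x\cdot(y\cdot m)=\epsilon(\alpha,\beta)\bigl((y\cdot x)\cdot m-y\cdot(x\cdot m)\bigr),$$ $$(x\cdot m)\cdot y-x\cdot(m\cdot y)=\epsilon(\alpha,\gamma)\bigl((m\cdot x)\cdot y-m\cdot(x\cdot y)\bigr).$$ The bracket $[x,y]=x\cdot y-\epsilon(\alpha,\beta)\,y\cdot x$ ($x\in S_\alpha$, $y\in S_\beta$) makes $S$ an $\epsilon$-Lie algebra $\mathfrak g_S$. A (left) $\mathfrak g_S$-module is a $\Gamma$-graded space $W$ with a bilinear action $(x,w)\mapsto[x,w]$ such that $[S_\alpha,W_\beta]\subseteq W_{\alpha+\beta}$ and $[[x,y],w]=[x,[y,w]]-\epsilon(\alpha,\beta)[y,[x,w]]$ for $x\in S_\alpha$, $y\in S_\beta$. **Cochains.** For $\beta\in\Gamma$, a multilinear map $f$ on $S^{n}$ has degree $\beta$ if $f(x_1,\dots,x_n)$ has degree $\beta+\alpha_1+\dots+\alpha_n$ whenever $x_s\in S_{\alpha_s}$;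 it is $\epsilon$-skew in two adjacent arguments if exchanging $x_s\in S_{\alpha_s}$ and $x_{s+1}\in S_{\alpha_{s+1}}$ gives $f(\dots,x_s,x_{s+1},\dots)=-\epsilon(\alpha_s,\alpha_{s+1})f(\dots,x_{s+1},x_s,\dots)$. For $i\ge 0$ let $$C^{i+1}(S,M)=\bigoplus_{\beta}\operatorname{Hom}_\beta(\wedge_\epsilon^{i}S\otimes S,M),$$ where $\operatorname{Hom}_\beta(\wedge_\epsilon^{i}S\otimes S,M)$ consists of the multilinear maps $S^{i+1}\to M$ of degree $\beta$ that are $\epsilon$-skew in the first $i$ arguments. In particular $C^1(S,M)=\operatorname{Hom}(S,M)$, graded by degree; it is a $\mathfrak g_S$-module via $$[x,f](y)=x\cdot f(y)-\epsilon(\alpha,\beta)f(x\cdot y)+\epsilon(\alpha,\beta)f(x)\cdot y,\qquad x\in S_\alpha,\ f\in C^1(S,M)_\beta .$$ For a $\mathfrak g_S$-module $W$ and $i\ge0$ let $$C^{i}(\mathfrak g_S,W)=\bigoplus_\beta\operatorname{Hom}_\beta(\wedge_\epsilon^{i}\mathfrak g_S,W),$$ where $\operatorname{Hom}_\beta(\wedge_\epsilon^{i}\mathfrak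 g_S,W)$ consists of the multilinear maps $S^i\to W$ of degree $\beta$ that are $\epsilon$-skew in all their arguments. **Actions of $\mathfrak g_S$.** For $x\in S_\alpha$, $f$ of degree $\beta$ and $x_s\in S_{\alpha_s}$, let, on $C^i(\mathfrak g_S,W)$, $$(\xi(x)f)(x_1,\dots,x_i)=[x,f(x_1,\dots,x_i)]-\sum_{j=1}^{i}\epsilon(\alpha,\beta+\alpha_1+\dots+\alpha_{j-1})f(x_1,\dots,[x,x_j],\dots,x_i),$$ and, on $C^{i+1}(S,M)$, with $e=\epsilon(\alpha,\beta+\alpha_1+\dots+\alpha_i)$, $$\begin{aligned}(\rho(x)f)(x_1,\dots,x_{i+1})={}&x\cdot f(x_1,\dots,x_{i+1})-e\,f(x_1,\dots,x_i,x\cdot x_{i+1})+e\,f(x_1,\dots,x_i,x)\cdot x_{i+1}\\&-\sum_{j=1}^{i}\epsilon(\alpha,\beta+\alpha_1+\dots+\alpha_{j-1})f(x_1,\dots,[x,x_j],\dots,x_i,x_{i+1}).\end{aligned}$$ **Coboundaries and cohomology.** For $f$ of degree $\beta$ and $x_s\in S_{\alpha_s}$, put $\epsilon_t=\epsilon(\beta+\alpha_1+\dots+\alpha_{t-1},\alpha_t)$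 and $\epsilon_{t,j}=\epsilon(\alpha_t,\alpha_{t+1}+\dots+\alpha_{j-1})$. Define $\mathfrak d:C^{i}(\mathfrak g_S,W)\to C^{i+1}(\mathfrak g_S,W)$, $i\ge 0$, by $$\begin{aligned}(\mathfrak d f)(x_1,\dots,x_{i+1})=\sum_{t=1}^{i+1}(-1)^{t+1}\Bigl(&\epsilon_t\,[x_t,f(x_1,\dots,\hat x_t,\dots,x_{i+1})]\\&-\sum_{t<j\le i+1}\epsilon_{t,j}\,f(x_1,\dots,\hat x_t,\dots,x_{j-1},[x_t,x_j],x_{j+1},\dots,x_{i+1})\Bigr),\end{aligned}$$ and $d:C^{i}(S,M)\to C^{i+1}(S,M)$, $i\ge1$, by $$\begin{aligned}(df)(x_1,\dots,x_{i+1})=\sum_{t=1}^{i}(-1)^{t+1}\Bigl(&\epsilon_t\,x_t\cdot f(x_1,\dots,\hat x_t,\dots,x_{i+1})-\epsilon_{t,i+1}\,f(x_1,\dots,\hat x_t,\dots,x_i,x_t\cdot x_{i+1})\\&+\epsilon_{t,i+1}\,f(x_1,\dots,\hat x_t,\dots,x_i,x_t)\cdot x_{i+1}\\&-\sum_{t<j\le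 i}\epsilon_{t,j}\,f(x_1,\dots,\hat x_t,\dots,x_{j-1},[x_t,x_j],x_{j+1},\dots,x_i,x_{i+1})\Bigr).\end{aligned}$$ Let $H^{i}_{\mathrm{Lie}}(\mathfrak g_S,W)$ be the space of $i$-cocycles (the kernel of $\mathfrak d$ on $C^i(\mathfrak g_S,W)$) modulo the $i$-coboundaries (the image of $\mathfrak d$ from $C^{i-1}(\mathfrak g_S,W)$), and for $i\ge 2$ let $H^i(S,M)$ be the kernel of $d$ on $C^i(S,M)$ modulo the image of $d$ from $C^{i-1}(S,M)$. **Theorem 4.1.** Let $S$ be a generalized left-symmetric algebra and $M$ an $S$-bimodule. For $i\ge0$ let $$\psi:C^{i}(\mathfrak g_S,C^{1}(S,M))\to C^{i+1}(S,M),\qquad \psi(f)(x_1,\dots,x_i,x_{i+1})=f(x_1,\dots,x_i)(x_{i+1}).$$ 1. For every $i\ge 0$, $\xi$ and $\rho$ make $C^{i}(\mathfrak g_S,C^1(S,M))$ and $C^{i+1}(S,M)$ into $\mathfrak g_S$-modules, and $\psi$ is an isomorphism of $\mathfrak g_S$-modules: it is linear and bijective, maps the component of each degree $\gamma\in\Gamma$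 onto the component of degree $\gamma$, and satisfies $\psi(\xi(x)f)=\rho(x)\psi(f)$ for all $x\in\mathfrak g_S$ and all $f$. 2. $\mathfrak d^2=0$ on $\bigoplus_{i\ge0}C^{i}(\mathfrak g_S,C^1(S,M))$, $d^2=0$ on $\bigoplus_{i\ge1}C^i(S,M)$, and $\psi\,\mathfrak d=d\,\psi$ on $C^{i}(\mathfrak g_S,C^1(S,M))$ for every $i\ge0$. Thus $\psi$ is an isomorphism of cochain complexes from $\bigoplus_{i\ge0}C^{i}(\mathfrak g_S,C^{1}(S,M))$ to $\bigoplus_{i\ge1}C^{i}(S,M)$. 3. Consequently, for every $i>0$, $\psi$ maps $i$-cocycles to $(i+1)$-cocycles and induces a linear isomorphism $$H^{i}_{\mathrm{Lie}}(\mathfrak g_S,C^{1}(S,M))\;\cong\;H^{i+1}(S,M).$$ -/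

import Mathlib

open scoped DirectSum

namespace GLSA

/-- A commutation factor on the abelian group `Γ` with values in `kˣ`. -/
structure CommutationFactor (Γ k : Type*) [AddCommGroup Γ] [Field k] where
  toFun : Γ → Γ → kˣ
  mul_swap' : ∀ α β, toFun α β * toFun β α = 1
  add_right' : ∀ α β γ, toFun α (β + γ) = toFun α β * toFun α γ
  add_left' : ∀ α β γ, toFun (α + β) γ = toFun α γ * toFun β γ

section Basic

variable {Γ k : Type*} [AddCommGroup Γ] [Field k]

/-- The value of a commutation factor, as a scalar of `k`. -/
def CommutationFactor.val (ε : CommutationFactor Γ k) (α β : Γ) : k := (ε.toFun α β : k)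

/-- `ε α β` is read as a scalar of `k`. -/
instance : CoeFun (CommutationFactor Γ k) (fun _ => Γ → Γ → k) := ⟨CommutationFactor.val⟩

namespace CommutationFactor

variable (ε : CommutationFactor Γ k)

theorem mul_swap (α β : Γ) : ε α β * ε β α = 1 := by
  simpa [val] using congrArg Units.val (ε.mul_swap' α β)

theorem add_right (α β γ : Γ) : ε α (β + γ) = ε α β * ε α γ := by
  simp [val, ε.add_right']

theorem add_left (α β γ : Γ) : ε (α + β) γ = ε α γ * ε β γ := by
  simp [val, ε.add_left']

theorem zero_right (α : Γ) : ε α 0 = 1 := by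
  have h := ε.add_right' α 0 0
  rw [add_zero] at h
  have h' : ε.toFun α 0 = 1 := by simpa using h
  simp [val, h']

end CommutationFactor

end Basic

section Lift

variable {Γ k : Type*} [DecidableEq Γ] [Field k]
variable {V U : Type*} [AddCommGroup V] [Module k V] [AddCommGroup U] [Module k U]
variable (𝒱 : Γ → Submodule k V) [DirectSum.Decomposition 𝒱]

/-- The linear map on a graded space that is `F α` on the component of degree `α`. -/
noncomputable def gradedLift (F : Γ → V →ₗ[k] U) : V →ₗ[k] U :=
  DirectSum.toModule k Γ U (fun α => (F α).comp (𝒱 α).subtype) ∘ₗ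
    (DirectSum.decomposeLinearEquiv 𝒱).toLinearMap

theorem gradedLift_apply (F : Γ → V →ₗ[k] U) {α : Γ} {v : V} (hv : v ∈ 𝒱 α) :
    gradedLift 𝒱 F v = F α v := by
  lift v to 𝒱 α using hv
  simp [gradedLift]

theorem linearMap_ext_of_homogeneous {f g : V →ₗ[k] U}
    (h : ∀ α, ∀ v ∈ 𝒱 α, f v = g v) : f = g := by
  apply DirectSum.decompose_lhom_ext 𝒱
  intro α
  ext v
  exact h α v v.2

/-- The multilinear map on a graded space that is `F α` on tuples whose `s`-th entry is
homogeneous of degree `α s`. -/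
noncomputable def gradedMultiLift {n : ℕ}
    (F : (Fin n → Γ) → MultilinearMap k (fun _ : Fin n => V) U) :
    MultilinearMap k (fun _ : Fin n => V) U :=
  (MultilinearMap.fromDirectSumEquiv (R := k) (ι := Fin n) (κ := fun _ => Γ)
    (M := fun _ α => 𝒱 α)
    (fun α => (F α).compLinearMap (fun s => (𝒱 (α s)).subtype))).compLinearMap
    (fun _ => (DirectSum.decomposeLinearEquiv 𝒱).toLinearMap)

theorem gradedMultiLift_apply {n : ℕ}
    (F : (Fin n → Γ) → MultilinearMap k (fun _ : Fin n => V) U)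
    {α : Fin n → Γ} {x : Fin n → V} (hx : ∀ s, x s ∈ 𝒱 (α s)) :
    gradedMultiLift 𝒱 F x = F α x := by
  have h := MultilinearMap.fromDirectSumEquiv_lof (R := k) (ι := Fin n) (κ := fun _ => Γ)
    (M := fun _ α => 𝒱 α)
    (fun α => (F α).compLinearMap (fun s => (𝒱 (α s)).subtype)) α (fun s => ⟨x s, hx s⟩)
  have e : (fun s => DirectSum.decomposeLinearEquiv 𝒱 (x s)) =
      fun s => DirectSum.lof k Γ (fun i => 𝒱 i) (α s) ⟨x s, hx s⟩ := by
    funext s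
    rw [DirectSum.decomposeLinearEquiv_apply, DirectSum.decompose_of_mem 𝒱 (hx s)]
    rfl
  simp only [gradedMultiLift, MultilinearMap.compLinearMap_apply, LinearEquiv.coe_coe]
  rw [e, h]
  simp

theorem multilinearMap_ext_of_homogeneous {n : ℕ}
    {f g : MultilinearMap k (fun _ : Fin n => V) U}
    (h : ∀ (α : Fin n → Γ) (x : Fin n → V), (∀ s, x s ∈ 𝒱 (α s)) → f x = g x) : f = g := by
  have key : ∀ f : MultilinearMap k (fun _ : Fin n => V) U, f = ((f.compLinearMap
      (fun _ => (DirectSum.decomposeLinearEquiv 𝒱).symm.toLinearMap)).compLinearMap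
      (fun _ => (DirectSum.decomposeLinearEquiv 𝒱).toLinearMap)) := by
    intro f; ext x; simp
  rw [key f, key g]
  congr 1
  apply MultilinearMap.dfinsupp_ext (κ := fun _ : Fin n => Γ) (M := fun _ α => 𝒱 α)
  intro α
  ext x
  have e : ∀ s, (DirectSum.decomposeLinearEquiv 𝒱).symm
      (DFinsupp.lsingle (R := k) (M := fun i => 𝒱 i) (α s) (x s)) = (x s : V) := fun s =>
    DirectSum.decomposeLinearEquiv_symm_lof 𝒱 (α s) (x s)
  have := h α (fun s => x s) (fun s => (x s).2)
  simp only [MultilinearMap.compLinearMap_apply, LinearEquiv.coe_coe]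
  erw [funext e]
  exact this

end Lift

section Algebra

variable {Γ k : Type*} [AddCommGroup Γ] [Field k] (ε : CommutationFactor Γ k)
variable {S M : Type*} [AddCommGroup S] [Module k S] [AddCommGroup M] [Module k M]

/-- A generalized left-symmetric algebra structure on the graded space `S = ⨁ 𝒮 γ`. -/
structure LeftSymmetricAlgebra (𝒮 : Γ → Submodule k S) where
  mul : S →ₗ[k] S →ₗ[k] S
  mul_mem : ∀ {α β : Γ} {x y : S}, x ∈ 𝒮 α → y ∈ 𝒮 β → mul x y ∈ 𝒮 (α + β)
  left_symm : ∀ {α β : Γ} {x y : S}, x ∈ 𝒮 α → y ∈ 𝒮 β → ∀ z : S,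
    mul (mul x y) z - mul x (mul y z) = ε α β • (mul (mul y x) z - mul y (mul x z))

/-- An `ε`-Lie algebra structure on the graded space `L = ⨁ ℒ γ`. -/
structure EpsLieAlgebra (ℒ : Γ → Submodule k S) where
  bracket : S →ₗ[k] S →ₗ[k] S
  bracket_mem : ∀ {α β : Γ} {x y : S}, x ∈ ℒ α → y ∈ ℒ β → bracket x y ∈ ℒ (α + β)
  skew : ∀ {α β : Γ} {x y : S}, x ∈ ℒ α → y ∈ ℒ β →
    bracket x y + ε α β • bracket y x = 0
  jacobi : ∀ {α β γ : Γ} {x y z : S}, x ∈ ℒ α → y ∈ ℒ β → z ∈ ℒ γ →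
    ε γ α • bracket x (bracket y z) + ε α β • bracket y (bracket z x) +
      ε β γ • bracket z (bracket x y) = 0

variable {ε}

/-- `act` makes the graded space `W = ⨁ 𝒲 γ` a left module over the `ε`-Lie algebra `𝔤`. -/
structure EpsLieAlgebra.IsModule {ℒ : Γ → Submodule k S} (𝔤 : EpsLieAlgebra ε ℒ)
    (𝒲 : Γ → Submodule k M) (act : S →ₗ[k] M →ₗ[k] M) : Prop where
  act_mem : ∀ {α β : Γ} {x : S} {m : M}, x ∈ ℒ α → m ∈ 𝒲 β → act x m ∈ 𝒲 (α + β)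
  act_bracket : ∀ {α β : Γ} {x y : S}, x ∈ ℒ α → y ∈ ℒ β → ∀ m : M,
    act (𝔤.bracket x y) m = act x (act y m) - ε α β • act y (act x m)

/-- A left module over the `ε`-Lie algebra `𝔤` on the graded space `W = ⨁ 𝒲 γ`. -/
structure EpsLieModule {ℒ : Γ → Submodule k S} (𝔤 : EpsLieAlgebra ε ℒ)
    (𝒲 : Γ → Submodule k M) where
  act : S →ₗ[k] M →ₗ[k] M
  isModule : 𝔤.IsModule 𝒲 act

/-- A bimodule over a generalized left-symmetric algebra, on the graded space `M = ⨁ ℳ γ`. -/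
structure Bimodule {𝒮 : Γ → Submodule k S} (A : LeftSymmetricAlgebra ε 𝒮)
    (ℳ : Γ → Submodule k M) where
  left : S →ₗ[k] M →ₗ[k] M
  right : M →ₗ[k] S →ₗ[k] M
  left_mem : ∀ {α β : Γ} {x : S} {m : M}, x ∈ 𝒮 α → m ∈ ℳ β → left x m ∈ ℳ (α + β)
  right_mem : ∀ {α β : Γ} {m : M} {x : S}, m ∈ ℳ α → x ∈ 𝒮 β → right m x ∈ ℳ (α + β)
  left_left : ∀ {α β : Γ} {x y : S}, x ∈ 𝒮 α → y ∈ 𝒮 β → ∀ m : M,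
    left (A.mul x y) m - left x (left y m) =
      ε α β • (left (A.mul y x) m - left y (left x m))
  left_right : ∀ {α γ : Γ} {x : S} {m : M}, x ∈ 𝒮 α → m ∈ ℳ γ → ∀ y : S,
    right (left x m) y - left x (right m y) =
      ε α γ • (right (right m x) y - right m (A.mul x y))

variable [DecidableEq Γ]

namespace LeftSymmetricAlgebra

variable {𝒮 : Γ → Submodule k S} [DirectSum.Decomposition 𝒮] (A : LeftSymmetricAlgebra ε 𝒮)

/-- The `ε`-commutator: `[x, y] = x · y - ε(α, β) y · x` for `x ∈ S_α`, `y ∈ S_β`, extended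
bilinearly. -/
noncomputable def commutator : S →ₗ[k] S →ₗ[k] S :=
  gradedLift 𝒮 fun α =>
    (gradedLift 𝒮 fun β => (A.mul - ε α β • A.mul.flip).flip).flip

theorem commutator_apply {α β : Γ} {x y : S} (hx : x ∈ 𝒮 α) (hy : y ∈ 𝒮 β) :
    A.commutator x y = A.mul x y - ε α β • A.mul y x := by
  rw [commutator, gradedLift_apply 𝒮 _ hx, LinearMap.flip_apply, gradedLift_apply 𝒮 _ hy]
  simp

theorem commutator_mem {α β : Γ} {x y : S} (hx : x ∈ 𝒮 α) (hy : y ∈ 𝒮 β) :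
    A.commutator x y ∈ 𝒮 (α + β) := by
  rw [A.commutator_apply hx hy]
  exact Submodule.sub_mem _ (A.mul_mem hx hy)
    (Submodule.smul_mem _ _ (add_comm β α ▸ A.mul_mem hy hx))

/-- The associated `ε`-Lie algebra `𝔤_S`. -/
noncomputable def lie : EpsLieAlgebra ε 𝒮 where
  bracket := A.commutator
  bracket_mem := A.commutator_mem
  skew {α β x y} hx hy := by
    rw [A.commutator_apply hx hy, A.commutator_apply hy hx, smul_sub, smul_smul, ε.mul_swap]
    module
  jacobi {α β γ x y z} hx hy hz := by
    rw [A.commutator_apply hx (A.commutator_mem hy hz),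
      A.commutator_apply hy (A.commutator_mem hz hx),
      A.commutator_apply hz (A.commutator_mem hx hy),
      A.commutator_apply hx hy, A.commutator_apply hy hz, A.commutator_apply hz hx]
    have h1 := A.left_symm hx hy z
    have h2 := A.left_symm hy hz x
    have h3 := A.left_symm hz hx y
    have e1 := ε.mul_swap α β
    have e2 := ε.mul_swap β γ
    have e3 := ε.mul_swap γ α
    simp only [ε.add_right, map_sub, map_smul, LinearMap.sub_apply, LinearMap.smul_apply]
    rw [sub_eq_iff_eq_add] at h1 h2 h3
    rw [h1, h2, h3]
    match_scalars <;> grind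

end LeftSymmetricAlgebra

end Algebra

section HomSpace

variable {Γ k : Type*} [AddCommGroup Γ] [DecidableEq Γ] [Field k]
variable {S M : Type*} [AddCommGroup S] [Module k S] [AddCommGroup M] [Module k M]

/-- `Hom_γ(S, M)`: the linear maps that are homogeneous of degree `γ`. -/
def homDeg (𝒮 : Γ → Submodule k S) (ℳ : Γ → Submodule k M) (γ : Γ) :
    Submodule k (S →ₗ[k] M) where
  carrier := {f | ∀ α, ∀ x ∈ 𝒮 α, f x ∈ ℳ (γ + α)}
  add_mem' hf hg α x hx := Submodule.add_mem _ (hf α x hx) (hg α x hx)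
  zero_mem' _ _ _ := Submodule.zero_mem _
  smul_mem' c _ hf α x hx := Submodule.smul_mem _ c (hf α x hx)

variable (𝒮 : Γ → Submodule k S) [DirectSum.Decomposition 𝒮]
variable (ℳ : Γ → Submodule k M) [DirectSum.Decomposition ℳ]

/-- The component of degree `γ` of a linear map. -/
noncomputable def homProj (γ : Γ) : (S →ₗ[k] M) →ₗ[k] homDeg 𝒮 ℳ γ where
  toFun f := ⟨gradedLift 𝒮 fun α => gradedLift ℳ (fun μ => if μ = γ + α then .id else 0) ∘ₗ f, by
    intro α x hx
    rw [gradedLift_apply 𝒮 _ hx, LinearMap.comp_apply]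
    induction f x using DirectSum.Decomposition.inductionOn ℳ with
    | zero => simp
    | homogeneous m =>
      rw [gradedLift_apply ℳ _ m.2]
      split_ifs with h
      · simp [← h]
      · simp
    | add m m' h h' => rw [map_add]; exact Submodule.add_mem _ h h'⟩
  map_add' f g := by
    ext1
    refine linearMap_ext_of_homogeneous 𝒮 fun α x hx => ?_
    simp [gradedLift_apply 𝒮 _ hx]
  map_smul' c f := by
    ext1
    refine linearMap_ext_of_homogeneous 𝒮 fun α x hx => ?_
    simp [gradedLift_apply 𝒮 _ hx]

theorem homProj_apply (γ : Γ) (f : S →ₗ[k] M) {α : Γ} {x : S} (hx : x ∈ 𝒮 α) :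
    (homProj 𝒮 ℳ γ f : S →ₗ[k] M) x =
      gradedLift ℳ (fun μ => if μ = γ + α then .id else 0) (f x) := by
  simp [homProj, gradedLift_apply 𝒮 _ hx]

theorem finite_degrees {Γ k S : Type*} [DecidableEq Γ] [Field k] [AddCommGroup S] [Module k S]
    (𝒱 : Γ → Submodule k S) [DirectSum.Decomposition 𝒱] [FiniteDimensional k S] : {γ | 𝒱 γ ≠ ⊥}.Finite :=
  WellFoundedGT.finite_ne_bot_of_iSupIndep
    (DirectSum.Decomposition.isInternal 𝒱).submodule_iSupIndep

variable [FiniteDimensional k S] [FiniteDimensional k M]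

/-- `Hom(S, M) = ⨁ Hom_γ(S, M)` for finite-dimensional graded spaces. -/
noncomputable instance homDecomposition : DirectSum.Decomposition (homDeg 𝒮 ℳ) :=
  let T : Finset Γ := Finset.image₂ (fun μ α => μ - α)
    (finite_degrees ℳ).toFinset (finite_degrees 𝒮).toFinset
  have hT : ∀ {γ α : Γ} {x : S}, x ∈ 𝒮 α → x ≠ 0 → ∀ {m : M}, m ∈ ℳ (γ + α) → m ≠ 0 →
      γ ∈ T := by
    intro γ α x hx hx0 m hm hm0
    refine Finset.mem_image₂.2 ⟨γ + α, ?_, α, ?_, by abel⟩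
    · simpa using fun h : ℳ (γ + α) = ⊥ => hm0 (by simpa [h] using hm)
    · simpa using fun h : 𝒮 α = ⊥ => hx0 (by simpa [h] using hx)
  DirectSum.Decomposition.ofLinearMap (homDeg 𝒮 ℳ)
    (∑ γ ∈ T, DirectSum.lof k Γ (fun γ => homDeg 𝒮 ℳ γ) γ ∘ₗ homProj 𝒮 ℳ γ)
    (by
      ext1 f
      simp only [LinearMap.comp_apply, LinearMap.sum_apply, map_sum, DirectSum.coeLinearMap_lof,
        LinearMap.id_apply]
      refine linearMap_ext_of_homogeneous 𝒮 fun α x hx => ?_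
      rw [LinearMap.sum_apply]
      simp only [homProj_apply 𝒮 ℳ _ f hx]
      by_cases hx0 : x = 0
      · simp [hx0]
      induction f x using DirectSum.Decomposition.inductionOn ℳ with
      | zero => simp
      | @homogeneous μ m =>
        simp only [gradedLift_apply ℳ _ m.2]
        by_cases hm : (m : M) = 0
        · simp [hm]
        · rw [Finset.sum_eq_single (μ - α)]
          · simp
          · intro γ _ hγ
            rw [if_neg (by rintro rfl; exact hγ (by abel))]
            simp
          · intro h
            exact absurd (hT (γ := μ - α) hx hx0 (m := m) (by simp) hm) h
      | add m m' h h' => simp only [map_add, Finset.sum_add_distrib, h, h'])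
    (by
      ext γ f : 2
      simp only [LinearMap.comp_apply, LinearMap.sum_apply, DirectSum.coeLinearMap_lof,
        LinearMap.id_apply]
      have hp : ∀ γ', homProj 𝒮 ℳ γ' (f : S →ₗ[k] M) = if h : γ = γ' then h ▸ f else 0 := by
        intro γ'
        ext1
        refine linearMap_ext_of_homogeneous 𝒮 fun α x hx => ?_
        rw [homProj_apply 𝒮 ℳ _ _ hx, gradedLift_apply ℳ _ (f.2 α x hx)]
        by_cases h : γ = γ'
        · subst h; simp
        · simp [h]
      by_cases hγ : γ ∈ T
      · rw [Finset.sum_eq_single γ]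
        · rw [hp]; simp
        · intro γ' _ h
          rw [hp, dif_neg (Ne.symm h), map_zero]
        · exact fun h => absurd hγ h
      · have hf : f = 0 := by
          ext1
          refine linearMap_ext_of_homogeneous 𝒮 fun α x hx => ?_
          by_contra hne
          refine hγ (hT hx ?_ (f.2 α x hx) hne)
          rintro rfl
          simp at hne
        simp [hf])

namespace Bimodule

variable {ε : CommutationFactor Γ k} {𝒮 ℳ} {A : LeftSymmetricAlgebra ε 𝒮} (B : Bimodule A ℳ)

/-- The left action of `S` on `C¹(S, M) = Hom(S, M)`:
`(x · f)(y) = x · f(y) - ε(α, γ) f(x · y) + ε(α, γ) f(x) · y` for `x ∈ S_α` and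
`f ∈ Hom_γ(S, M)`, extended bilinearly. -/
noncomputable def homAct : S →ₗ[k] (S →ₗ[k] M) →ₗ[k] (S →ₗ[k] M) :=
  gradedLift 𝒮 fun α => (gradedLift (homDeg 𝒮 ℳ) fun γ =>
    LinearMap.mk₂ k (fun f x => B.left x ∘ₗ f - ε α γ • (f ∘ₗ A.mul x) + ε α γ • B.right (f x))
      (by intros; ext; simp; module) (by intros; ext; simp; module)
      (by intros; ext; simp; module) (by intros; ext; simp; module)).flip

theorem homAct_apply {α γ : Γ} {x : S} {f : S →ₗ[k] M} (hx : x ∈ 𝒮 α) (hf : f ∈ homDeg 𝒮 ℳ γ)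
    (y : S) : B.homAct x f y =
      B.left x (f y) - ε α γ • f (A.mul x y) + ε α γ • B.right (f x) y := by
  rw [homAct, gradedLift_apply 𝒮 _ hx, LinearMap.flip_apply, gradedLift_apply _ _ hf]
  simp

theorem homAct_mem {α γ : Γ} {x : S} {f : S →ₗ[k] M} (hx : x ∈ 𝒮 α) (hf : f ∈ homDeg 𝒮 ℳ γ) :
    B.homAct x f ∈ homDeg 𝒮 ℳ (α + γ) := by
  intro β y hy
  rw [B.homAct_apply hx hf]
  have h1 := B.left_mem hx (hf β y hy)
  have h2 := hf _ _ (A.mul_mem hx hy)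
  have h3 := B.right_mem (hf α x hx) hy
  have e1 : α + (γ + β) = α + γ + β := by abel
  have e2 : γ + (α + β) = α + γ + β := by abel
  have e3 : γ + α + β = α + γ + β := by abel
  rw [e1] at h1; rw [e2] at h2; rw [e3] at h3
  exact Submodule.add_mem _ (Submodule.sub_mem _ h1 (Submodule.smul_mem _ _ h2))
    (Submodule.smul_mem _ _ h3)

/-- `C¹(S, M) = Hom(S, M)` as a module over `𝔤_S`. -/
noncomputable def homModule : EpsLieModule A.lie (homDeg 𝒮 ℳ) where
  act := B.homAct
  isModule := {
    act_mem := B.homAct_mem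
    act_bracket := by
      intro α β x y hx hy f
      induction f using DirectSum.Decomposition.inductionOn (homDeg 𝒮 ℳ) with
      | zero => simp
      | add f g hf hg => simp only [map_add, hf, hg]; module
      | @homogeneous γ f =>
        obtain ⟨f, hf⟩ := f
        refine linearMap_ext_of_homogeneous 𝒮 fun δ z hz => ?_
        simp only [LinearMap.sub_apply, LinearMap.smul_apply]
        have hc : A.lie.bracket x y = A.mul x y - ε α β • A.mul y x := A.commutator_apply hx hy
        rw [B.homAct_apply (A.lie.bracket_mem hx hy) hf, B.homAct_apply hx (B.homAct_mem hy hf),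
          B.homAct_apply hy (B.homAct_mem hx hf), B.homAct_apply hy hf, B.homAct_apply hy hf,
          B.homAct_apply hy hf, B.homAct_apply hx hf, B.homAct_apply hx hf,
          B.homAct_apply hx hf, hc]
        have e1 := ε.mul_swap α β
        have h1 := A.left_symm hx hy z
        have h2 := B.left_left hx hy (f z)
        have h3 := B.left_right hx (hf _ y hy) z
        have h4 := B.left_right hy (hf _ x hx) z
        simp only [ε.add_right, ε.add_left, map_sub, map_smul, map_add, LinearMap.sub_apply,
          LinearMap.smul_apply, LinearMap.add_apply] at h3 h4 ⊢
        have h1' := congrArg f h1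
        simp only [map_sub, map_smul] at h1'
        rw [sub_eq_iff_eq_add] at h1' h2 h3 h4
        rw [h1', h2, h3, h4]
        match_scalars <;> grind }

end Bimodule

end HomSpace

section Combinatorics

/-! The `ε`-skew symmetry of the coboundary and of the action, on tuples of homogeneous
elements: `E` is the type of homogeneous elements, with degree `deg` and bracket `br`. -/

variable {Γ k : Type*} [AddCommGroup Γ] [Field k] (ε : CommutationFactor Γ k)
variable {E W : Type*} [AddCommGroup W] [Module k W] (deg : E → Γ) (br : E → E → E)

def TupleSkew {n : ℕ} (F : (Fin n → E) → W) : Prop :=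
  ∀ (x : Fin n → E) (p q : Fin n), (p : ℕ) + 1 = q →
    F x = -(ε (deg (x p)) (deg (x q)) • F (x ∘ Equiv.swap p q))

def BracketSkew {n : ℕ} (F : (Fin n → E) → W) : Prop :=
  ∀ (x : Fin n → E) (j : Fin n) (a b : E),
    F (Function.update x j (br a b)) = -(ε (deg a) (deg b) • F (Function.update x j (br b a)))

def tupleAct {n : ℕ} (u : E) (F : (Fin n → E) → W) (y : Fin n → E) : W :=
  ∑ j, ε (deg u) (∑ s with s < j, deg (y s)) • F (Function.update y j (br u (y j)))

def tupleCobound {n : ℕ} (β : Γ) (P : E → (Fin n → E) → W) (F : (Fin n → E) → W)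
    (x : Fin (n + 1) → E) : W :=
  ∑ t : Fin (n + 1), (-1 : k) ^ (t : ℕ) •
    (ε (β + ∑ s with s < t, deg (x s)) (deg (x t)) • P (x t) (t.removeNth x) -
      ∑ j : Fin n with t < t.succAbove j,
        ε (deg (x t)) (∑ s with t < s ∧ s < t.succAbove j, deg (x s)) •
          F (Function.update (t.removeNth x) j (br (x t) (x (t.succAbove j)))))

variable {ε deg br}

theorem tupleSkew_cons {n : ℕ} {F : (Fin (n + 1) → E) → W}
    (h : ∀ a, TupleSkew ε deg (fun r => F (Fin.cons a r)))
    (h0 : ∀ (x : Fin (n + 1) → E) (hn : 0 < n),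
      F x = -(ε (deg (x 0)) (deg (x ⟨1, by omega⟩)) •
        F (x ∘ Equiv.swap 0 ⟨1, by omega⟩))) : TupleSkew ε deg F := by
  intro x p q hpq
  cases p using Fin.cases with
  | zero =>
    have hn : 0 < n := by have := q.2; simp at hpq; omega
    have : q = ⟨1, by omega⟩ := by ext; simpa using hpq.symm
    rw [this]
    exact h0 x hn
  | succ p =>
    cases q using Fin.cases with
    | zero => simp at hpq
    | succ q =>
      have := h (x 0) (Fin.tail x) p q (by simpa using hpq)
      simp only [Fin.cons_self_tail] at this
      rw [this]
      have e : (Fin.cons (x 0) (Fin.tail x ∘ Equiv.swap p q) : Fin (n + 1) → E) =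
          x ∘ Equiv.swap p.succ q.succ := by
        funext s
        cases s using Fin.cases with
        | zero => simp [Equiv.swap_apply_of_ne_of_ne (Fin.succ_ne_zero p).symm
            (Fin.succ_ne_zero q).symm]
        | succ s =>
          simp only [Fin.cons_succ, Function.comp_apply, Fin.tail]
          congr 1
          simp only [Equiv.swap_apply_def, Fin.succ_inj]
          split_ifs <;> rfl
      rw [e]
      rfl

theorem TupleSkew.cons {n : ℕ} {F : (Fin (n + 1) → E) → W} (h : TupleSkew ε deg F) (a : E) :
    TupleSkew ε deg (fun r => F (Fin.cons a r)) := by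
  intro x p q hpq
  have := h (Fin.cons a x) p.succ q.succ (by simpa using hpq)
  simp only [Fin.cons_succ] at this
  refine this.trans ?_
  congr 3
  funext s
  cases s using Fin.cases with
  | zero => simp [Equiv.swap_apply_of_ne_of_ne (Fin.succ_ne_zero p).symm
      (Fin.succ_ne_zero q).symm]
  | succ s =>
    simp only [Fin.cons_succ, Function.comp_apply]
    rw [← Fin.cons_succ (α := fun _ => E) a x]
    congr 1
    simp only [Equiv.swap_apply_def, Fin.succ_inj]
    split_ifs <;> rfl

theorem cons_cons_swap {n : ℕ} (a b : E) (r : Fin n → E) :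
    (Fin.cons a (Fin.cons b r) : Fin (n + 2) → E) ∘ Equiv.swap 0 ⟨1, by omega⟩ =
      Fin.cons b (Fin.cons a r) := by
  funext s
  refine Fin.cases ?_ (fun s => Fin.cases ?_ (fun s => ?_) s) s
  · rw [Function.comp_apply, Equiv.swap_apply_left]; rfl
  · have : (Fin.succ 0 : Fin (n + 2)) = ⟨1, by omega⟩ := rfl
    rw [Function.comp_apply, this, Equiv.swap_apply_right]; rfl
  · rw [Function.comp_apply, Equiv.swap_apply_of_ne_of_ne]
    · rfl
    · exact Fin.succ_ne_zero _
    · intro h; simp [Fin.ext_iff] at h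

theorem TupleSkew.cons_cons {n : ℕ} {F : (Fin (n + 2) → E) → W} (h : TupleSkew ε deg F)
    (a b : E) (r : Fin n → E) : F (Fin.cons a (Fin.cons b r)) =
      -(ε (deg a) (deg b) • F (Fin.cons b (Fin.cons a r))) := by
  have := h (Fin.cons a (Fin.cons b r)) 0 ⟨1, by omega⟩ (by simp)
  rwa [cons_cons_swap] at this

theorem tupleSkew_cons_cons {n : ℕ} {F : (Fin (n + 2) → E) → W}
    (h : ∀ a, TupleSkew ε deg (fun r => F (Fin.cons a r)))
    (h0 : ∀ (a b : E) (r : Fin n → E), F (Fin.cons a (Fin.cons b r)) =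
      -(ε (deg a) (deg b) • F (Fin.cons b (Fin.cons a r)))) : TupleSkew ε deg F := by
  refine tupleSkew_cons h fun x _ => ?_
  have hx : x = Fin.cons (x 0) (Fin.cons (x ⟨1, by omega⟩) (Fin.tail (Fin.tail x))) := by
    funext s
    refine Fin.cases ?_ (fun s => Fin.cases ?_ (fun s => ?_) s) s <;> rfl
  have := h0 (x 0) (x ⟨1, by omega⟩) (Fin.tail (Fin.tail x))
  rwa [← cons_cons_swap (x 0), ← hx] at this

theorem BracketSkew.cons {n : ℕ} {F : (Fin (n + 1) → E) → W} (h : BracketSkew ε deg br F)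
    (a : E) : BracketSkew ε deg br (fun r => F (Fin.cons a r)) := by
  intro x j b c
  have := h (Fin.cons a x) j.succ b c
  rwa [← Fin.cons_update, ← Fin.cons_update] at this

theorem tupleAct_cons {n : ℕ} (u a : E) (F : (Fin (n + 1) → E) → W) (r : Fin n → E) :
    tupleAct ε deg br u F (Fin.cons a r) = F (Fin.cons (br u a) r) +
      ε (deg u) (deg a) • tupleAct ε deg br u (fun r => F (Fin.cons a r)) r := by
  simp only [tupleAct, Fin.sum_univ_succ, Finset.smul_sum, Finset.sum_filter]
  congr 1
  · simp [ε.zero_right]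
  · refine Finset.sum_congr rfl fun j _ => ?_
    simp [ε.add_right, smul_smul, Fin.cons_update]

theorem tupleSkew_tupleAct (hbr : ∀ a b, deg (br a b) = deg a + deg b) {n : ℕ} (u : E)
    {F : (Fin n → E) → W} (h : TupleSkew ε deg F) : TupleSkew ε deg (tupleAct ε deg br u F) := by
  induction n with
  | zero => intro x p; exact p.elim0
  | succ n ih =>
    cases n with
    | zero => intro x p q hpq; omega
    | succ n =>
      refine tupleSkew_cons_cons (fun a => ?_) (fun a b r => ?_)
      · intro x p q hpq
        have h1 := (h.cons (br u a)) x p q hpq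
        have h2 := ih (h.cons a) x p q hpq
        simp only [tupleAct_cons] at h1 h2 ⊢
        rw [h1, h2]
        module
      · simp only [tupleAct_cons]
        have h1 := h.cons_cons (br u a) b r
        have h2 := h.cons_cons a (br u b) r
        have h3 : tupleAct ε deg br u (fun r => F (Fin.cons a (Fin.cons b r))) r =
            -(ε (deg a) (deg b) •
              tupleAct ε deg br u (fun r => F (Fin.cons b (Fin.cons a r))) r) := by
          simp only [tupleAct, Finset.smul_sum, ← Finset.sum_neg_distrib]
          refine Finset.sum_congr rfl fun j _ => ?_
          rw [h.cons_cons a b]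
          module
        rw [h1, h2, h3, hbr, hbr, ε.add_left, ε.add_right]
        have e := ε.mul_swap (deg u) (deg a)
        match_scalars <;> grind

theorem tupleCobound_cons {n : ℕ} (β : Γ) (P : E → (Fin (n + 1) → E) → W)
    (F : (Fin (n + 1) → E) → W) (a : E) (r : Fin (n + 1) → E) :
    tupleCobound ε deg br β P F (Fin.cons a r) =
      ε β (deg a) • P a r - tupleAct ε deg br a F r -
        tupleCobound ε deg br (β + deg a) (fun u y => P u (Fin.cons a y))
          (fun y => F (Fin.cons a y)) r := by
  rw [tupleCobound, Fin.sum_univ_succ, sub_eq_add_neg (_ - _) (tupleCobound _ _ _ _ _ _ _)]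
  congr 1
  · have h0 : ∀ j : Fin (n + 1), (∑ s with (0 : Fin (n + 2)) < s ∧ s < Fin.succAbove 0 j,
        deg ((Fin.cons a r : Fin (n + 2) → E) s)) = ∑ s with s < j, deg (r s) := by
      intro j
      rw [Finset.sum_filter, Fin.sum_univ_succ, Finset.sum_filter]
      simp
    have h1 : (∑ s with s < (0 : Fin (n + 2)), deg ((Fin.cons a r : Fin (n + 2) → E) s)) = 0 := by
      simp
    simp only [h0, h1]
    simp only [Fin.removeNth_zero, Fin.succAbove_zero, Fin.succ_pos, Finset.filter_true,
      Fin.cons_zero, Fin.cons_succ, Fin.tail_cons, Fin.val_zero, pow_zero, one_smul, add_zero,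
      tupleAct]
  · rw [tupleCobound, ← Finset.sum_neg_distrib]
    refine Finset.sum_congr rfl fun t _ => ?_
    have hr : (Fin.removeNth t.succ (Fin.cons a r : Fin (n + 2) → E) : Fin (n + 1) → E) =
        Fin.cons a (t.removeNth r) := by
      funext s
      cases s using Fin.cases with
      | zero => simp [Fin.removeNth]
      | succ s => simp [Fin.removeNth]
    have h1 : (∑ s with s < t.succ, deg ((Fin.cons a r : Fin (n + 2) → E) s)) =
        deg a + ∑ s with s < t, deg (r s) := by
      rw [Finset.sum_filter, Fin.sum_univ_succ, Finset.sum_filter]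
      simp
    have h2 : ∀ j : Fin n, (∑ s with t.succ < s ∧ s < t.succ.succAbove j.succ,
        deg ((Fin.cons a r : Fin (n + 2) → E) s)) =
          ∑ s with t < s ∧ s < t.succAbove j, deg (r s) := by
      intro j
      rw [Finset.sum_filter, Fin.sum_univ_succ, Finset.sum_filter]
      simp
    have h3 : ∀ G : Fin (n + 1) → W, (∑ j with t.succ < t.succ.succAbove j, G j) =
        ∑ j : Fin n with t < t.succAbove j, G j.succ := by
      intro G
      rw [Finset.sum_filter, Fin.sum_univ_succ, Finset.sum_filter]
      simp
    rw [hr, h1, h3]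
    simp only [h2]
    simp only [Fin.val_succ, pow_succ, Fin.cons_succ, Fin.succ_succAbove_succ,
      Fin.cons_update, add_assoc]
    module

theorem tupleCobound_zero (β : Γ) (P : E → (Fin 0 → E) → W) (F : (Fin 0 → E) → W) (a : E)
    (r : Fin 0 → E) : tupleCobound ε deg br β P F (Fin.cons a r) = ε β (deg a) • P a r := by
  simp [tupleCobound]

theorem tupleSkew_tupleCobound (hbr : ∀ a b, deg (br a b) = deg a + deg b) {n : ℕ} (β : Γ)
    {P : E → (Fin n → E) → W} {F : (Fin n → E) → W} (hP : ∀ u, TupleSkew ε deg (P u))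
    (hF : TupleSkew ε deg F) (hF' : BracketSkew ε deg br F) :
    TupleSkew ε deg (tupleCobound ε deg br β P F) := by
  induction n generalizing β with
  | zero => intro x p q hpq; omega
  | succ n ih =>
    refine tupleSkew_cons_cons (fun a => ?_) (fun a b r => ?_)
    · intro x p q hpq
      have h1 := hP a x p q hpq
      have h2 := tupleSkew_tupleAct hbr a hF x p q hpq
      have h3 := ih (β + deg a) (fun u => (hP u).cons a) (hF.cons a) (hF'.cons a) x p q hpq
      simp only [tupleCobound_cons]
      rw [h1, h2, h3]
      module
    · have hb : F (Fin.cons (br a b) r) = -(ε (deg a) (deg b) • F (Fin.cons (br b a) r)) := by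
        simpa [Fin.update_cons_zero] using hF' (Fin.cons a r) 0 a b
      have e := ε.mul_swap (deg a) (deg b)
      simp only [tupleCobound_cons, tupleAct_cons, hb]
      cases n with
      | zero =>
        simp only [tupleCobound_zero, tupleAct, Finset.univ_eq_empty, Finset.sum_empty,
          ε.add_left]
        match_scalars <;> grind
      | succ n =>
        have h3 : tupleCobound ε deg br (β + deg a + deg b)
            (fun u y => P u (Fin.cons a (Fin.cons b y)))
            (fun y => F (Fin.cons a (Fin.cons b y))) r = -(ε (deg a) (deg b) •
              tupleCobound ε deg br (β + deg b + deg a)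
                (fun u y => P u (Fin.cons b (Fin.cons a y)))
                (fun y => F (Fin.cons b (Fin.cons a y))) r) := by
          rw [show β + deg b + deg a = β + deg a + deg b by abel]
          simp only [tupleCobound, Finset.smul_sum, ← Finset.sum_neg_distrib, hF.cons_cons a b,
            (hP _).cons_cons a b]
          refine Finset.sum_congr rfl fun t _ => ?_
          simp only [smul_neg, Finset.sum_neg_distrib, smul_sub, Finset.smul_sum, smul_smul]
          simp only [mul_comm, mul_left_comm]
          module
        simp only [tupleCobound_cons, h3, ε.add_left]
        match_scalars <;> grind

end Combinatorics

section Cochains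

variable {Γ k : Type*} [AddCommGroup Γ] [Field k]
variable {V W U : Type*} [AddCommGroup V] [Module k V] [AddCommGroup W] [Module k W]
  [AddCommGroup U] [Module k U]

/-- The multilinear maps `f` of `n` variables that are homogeneous of degree `β` and `ε`-skew
symmetric in the first `m` variables:
`f(…, x_p, x_{p+1}, …) = -ε(α_p, α_{p+1}) f(…, x_{p+1}, x_p, …)` on homogeneous arguments.
For `m = n` this is `Hom_β(⋀_ε^n V, W)`; for `n = m + 1` it is `Hom_β(⋀_ε^m V ⊗ V, W)`. -/
def cochains (ε : CommutationFactor Γ k) (𝒱 : Γ → Submodule k V) (𝒲 : Γ → Submodule k W)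
    (n m : ℕ) (β : Γ) : Submodule k (MultilinearMap k (fun _ : Fin n => V) W) where
  carrier := {f | ∀ (α : Fin n → Γ) (x : Fin n → V), (∀ s, x s ∈ 𝒱 (α s)) →
    f x ∈ 𝒲 (β + ∑ s, α s) ∧
    ∀ p q : Fin n, (p : ℕ) + 1 = q → (q : ℕ) < m →
      f x = -(ε (α p) (α q) • f (x ∘ Equiv.swap p q))}
  add_mem' {f g} hf hg α x hx :=
    ⟨Submodule.add_mem _ (hf α x hx).1 (hg α x hx).1, fun p q hpq hq => by
      rw [add_apply, add_apply, (hf α x hx).2 p q hpq hq,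
        (hg α x hx).2 p q hpq hq]
      module⟩
  zero_mem' α x _ := ⟨Submodule.zero_mem _, fun p q _ _ => by simp⟩
  smul_mem' c f hf α x hx :=
    ⟨Submodule.smul_mem _ c (hf α x hx).1, fun p q hpq hq => by
      rw [smul_apply, smul_apply, (hf α x hx).2 p q hpq hq]
      module⟩

/-- The elements of `cochains ε 𝒱 𝒲 n m β`, as a vector space. -/
def CochainSpace (ε : CommutationFactor Γ k) (𝒱 : Γ → Submodule k V) (𝒲 : Γ → Submodule k W)
    (n m : ℕ) (β : Γ) : Type _ := ↥(cochains ε 𝒱 𝒲 n m β)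

namespace CochainSpace

variable {ε : CommutationFactor Γ k} {𝒱 : Γ → Submodule k V} {𝒲 : Γ → Submodule k W}
  {n m : ℕ} {β : Γ}

instance : AddCommGroup (CochainSpace ε 𝒱 𝒲 n m β) :=
  inferInstanceAs (AddCommGroup ↥(cochains ε 𝒱 𝒲 n m β))

instance : Module k (CochainSpace ε 𝒱 𝒲 n m β) :=
  inferInstanceAs (Module k ↥(cochains ε 𝒱 𝒲 n m β))

/-- The underlying multilinear map. -/
def map (f : CochainSpace ε 𝒱 𝒲 n m β) : MultilinearMap k (fun _ : Fin n => V) W := f.1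

theorem map_mem (f : CochainSpace ε 𝒱 𝒲 n m β) : f.map ∈ cochains ε 𝒱 𝒲 n m β := f.2

/-- The cochain given by a multilinear map with the required properties. -/
def mk (f : MultilinearMap k (fun _ : Fin n => V) W) (hf : f ∈ cochains ε 𝒱 𝒲 n m β) :
    CochainSpace ε 𝒱 𝒲 n m β := ⟨f, hf⟩

theorem map_mk {f : MultilinearMap k (fun _ : Fin n => V) W} (hf : f ∈ cochains ε 𝒱 𝒲 n m β) :
    (mk f hf).map = f := rfl

theorem map_add (f g : CochainSpace ε 𝒱 𝒲 n m β) : (f + g).map = f.map + g.map := rfl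

theorem map_smul (c : k) (f : CochainSpace ε 𝒱 𝒲 n m β) : (c • f).map = c • f.map := rfl

theorem ext {f g : CochainSpace ε 𝒱 𝒲 n m β} (h : f.map = g.map) : f = g := Subtype.ext h

end CochainSpace

/-- `(x_0, …, x_n) ↦ b(x_t, f(x_0, …, x̂_t, …, x_n))`. -/
def insertAct {n : ℕ} (b : V →ₗ[k] W →ₗ[k] U) (f : MultilinearMap k (fun _ : Fin n => V) W)
    (t : Fin (n + 1)) : MultilinearMap k (fun _ : Fin (n + 1) => V) U :=
  MultilinearMap.mk' (fun x => b (x t) (f (t.removeNth x)))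
    (by
      intro x i v w
      rcases Fin.eq_self_or_eq_succAbove t i with rfl | ⟨l, rfl⟩
      · simp
      · simp [Fin.removeNth_update_succAbove])
    (by
      intro x i c v
      rcases Fin.eq_self_or_eq_succAbove t i with rfl | ⟨l, rfl⟩
      · simp
      · simp [Fin.removeNth_update_succAbove])

/-- `(x_0, …, x_n) ↦ f(x_0, …, x̂_t, …, b(x_t, x_{j'}), …, x_n)`, where `b(x_t, x_{j'})` replaces
the `j`-th entry `x_{j'}` of the tuple without `x_t`. -/
def insertBracket {n : ℕ} (b : V →ₗ[k] V →ₗ[k] V) (f : MultilinearMap k (fun _ : Fin n => V) W)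
    (t : Fin (n + 1)) (j : Fin n) : MultilinearMap k (fun _ : Fin (n + 1) => V) W :=
  MultilinearMap.mk'
    (fun x => f (Function.update (t.removeNth x) j (b (x t) (x (t.succAbove j)))))
    (by
      intro x i v w
      rcases Fin.eq_self_or_eq_succAbove t i with rfl | ⟨l, rfl⟩
      · simp
      · rcases eq_or_ne l j with rfl | hl
        · simp [Fin.removeNth_update_succAbove]
        · have : t.succAbove j ≠ t.succAbove l := fun h => hl (Fin.succAbove_right_injective h).symm
          simp [Fin.removeNth_update_succAbove, this, Function.update_comm hl])
    (by
      intro x i c v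
      rcases Fin.eq_self_or_eq_succAbove t i with rfl | ⟨l, rfl⟩
      · simp
      · rcases eq_or_ne l j with rfl | hl
        · simp [Fin.removeNth_update_succAbove]
        · have : t.succAbove j ≠ t.succAbove l := fun h => hl (Fin.succAbove_right_injective h).symm
          simp [Fin.removeNth_update_succAbove, this, Function.update_comm hl])

/-- `(x_0, …, x_n) ↦ b(f(x_0, …, x̂_t, …, x_t, …, x_n), x_{j'})`, where `x_t` replaces the `j`-th
entry `x_{j'}` of the tuple without `x_t`. -/
def insertRight {n : ℕ} (b : W →ₗ[k] V →ₗ[k] U) (f : MultilinearMap k (fun _ : Fin n => V) W)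
    (t : Fin (n + 1)) (j : Fin n) : MultilinearMap k (fun _ : Fin (n + 1) => V) U :=
  MultilinearMap.mk'
    (fun x => b (f (Function.update (t.removeNth x) j (x t))) (x (t.succAbove j)))
    (by
      intro x i v w
      rcases Fin.eq_self_or_eq_succAbove t i with rfl | ⟨l, rfl⟩
      · simp
      · rcases eq_or_ne l j with rfl | hl
        · simp [Fin.removeNth_update_succAbove]
        · have : t.succAbove j ≠ t.succAbove l := fun h => hl (Fin.succAbove_right_injective h).symm
          simp [Fin.removeNth_update_succAbove, this, Function.update_comm hl])
    (by
      intro x i c v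
      rcases Fin.eq_self_or_eq_succAbove t i with rfl | ⟨l, rfl⟩
      · simp
      · rcases eq_or_ne l j with rfl | hl
        · simp [Fin.removeNth_update_succAbove]
        · have : t.succAbove j ≠ t.succAbove l := fun h => hl (Fin.succAbove_right_injective h).symm
          simp [Fin.removeNth_update_succAbove, this, Function.update_comm hl])

/-- `(x_1, …, x_n) ↦ f(x_1, …, φ(x_j), …, x_n)`. -/
def applyAt {n : ℕ} (φ : V →ₗ[k] V) (f : MultilinearMap k (fun _ : Fin n => V) W)
    (j : Fin n) : MultilinearMap k (fun _ : Fin n => V) W :=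
  MultilinearMap.mk' (fun x => f (Function.update x j (φ (x j))))
    (by
      intro x i v w
      rcases eq_or_ne i j with rfl | hi
      · simp
      · simp [hi.symm, Function.update_comm hi])
    (by
      intro x i c v
      rcases eq_or_ne i j with rfl | hi
      · simp
      · simp [hi.symm, Function.update_comm hi])

/-- `(x_1, …, x_n) ↦ b(f(x_1, …, u, …, x_n), x_j)`, where `u` replaces `x_j`. -/
def replaceAt {n : ℕ} (b : W →ₗ[k] V →ₗ[k] U) (u : V)
    (f : MultilinearMap k (fun _ : Fin n => V) W) (j : Fin n) :
    MultilinearMap k (fun _ : Fin n => V) U :=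
  MultilinearMap.mk' (fun x => b (f (Function.update x j u)) (x j))
    (by
      intro x i v w
      rcases eq_or_ne i j with rfl | hi
      · simp
      · simp [hi.symm, Function.update_comm hi])
    (by
      intro x i c v
      rcases eq_or_ne i j with rfl | hi
      · simp
      · simp [hi.symm, Function.update_comm hi])

section
variable {n : ℕ} (f : MultilinearMap k (fun _ : Fin n => V) W)

theorem insertAct_apply (b : V →ₗ[k] W →ₗ[k] U) (t : Fin (n + 1)) (x : Fin (n + 1) → V) :
    insertAct b f t x = b (x t) (f (t.removeNth x)) := rfl

theorem insertBracket_apply (b : V →ₗ[k] V →ₗ[k] V) (t : Fin (n + 1)) (j : Fin n)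
    (x : Fin (n + 1) → V) : insertBracket b f t j x =
      f (Function.update (t.removeNth x) j (b (x t) (x (t.succAbove j)))) := rfl

theorem insertRight_apply (b : W →ₗ[k] V →ₗ[k] U) (t : Fin (n + 1)) (j : Fin n)
    (x : Fin (n + 1) → V) : insertRight b f t j x =
      b (f (Function.update (t.removeNth x) j (x t))) (x (t.succAbove j)) := rfl

theorem applyAt_apply (φ : V →ₗ[k] V) (j : Fin n) (x : Fin n → V) :
    applyAt φ f j x = f (Function.update x j (φ (x j))) := rfl

theorem replaceAt_apply (b : W →ₗ[k] V →ₗ[k] U) (u : V) (j : Fin n) (x : Fin n → V) :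
    replaceAt b u f j x = b (f (Function.update x j u)) (x j) := rfl

end

section
variable {ε : CommutationFactor Γ k} {𝒱 : Γ → Submodule k V} {𝒲 : Γ → Submodule k W}

theorem map_mem_of_update {n m : ℕ} {β : Γ} {f : MultilinearMap k (fun _ : Fin n => V) W}
    (hf : f ∈ cochains ε 𝒱 𝒲 n m β) {α : Fin n → Γ} {x : Fin n → V}
    (hx : ∀ s, x s ∈ 𝒱 (α s)) (j : Fin n) {v : V} {δ μ : Γ} (hv : v ∈ 𝒱 δ)
    (hμ : μ + α j = β + ∑ s, α s + δ) : f (Function.update x j v) ∈ 𝒲 μ := by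
  have h := (hf (Function.update α j δ) (Function.update x j v) (fun s => by
    rcases eq_or_ne s j with rfl | hs
    · simpa using hv
    · simpa [hs] using hx s)).1
  rw [Finset.sum_update_of_mem (Finset.mem_univ j)] at h
  rw [← Finset.sum_sdiff (Finset.subset_univ {j}), Finset.sum_singleton] at hμ
  have : μ = β + (δ + ∑ s ∈ Finset.univ \ {j}, α s) :=
    add_right_cancel (b := α j) (by rw [hμ]; abel)
  rwa [this]

end

end Cochains

section Total

variable {Γ k : Type*} [AddCommGroup Γ] [DecidableEq Γ] [Field k]
variable {V : Type*} [AddCommGroup V] [Module k V] (𝒱 : Γ → Submodule k V)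
  [DirectSum.Decomposition 𝒱]
variable {C : Γ → Type*} [∀ β, AddCommGroup (C β)] [∀ β, Module k (C β)]

/-- The bilinear action of `V` on `⨁ C_β` with components `V_α × C_β → C_{α + β}`. -/
noncomputable def totalAct (φ : ∀ α β, 𝒱 α →ₗ[k] C β →ₗ[k] C (α + β)) :
    V →ₗ[k] (⨁ β, C β) →ₗ[k] (⨁ β, C β) :=
  DirectSum.toModule k Γ ((⨁ β, C β) →ₗ[k] (⨁ β, C β))
    (fun α => (DirectSum.toModule k Γ (𝒱 α →ₗ[k] (⨁ β, C β))
      (fun β => ((φ α β).compr₂ (DirectSum.lof k Γ C (α + β))).flip)).flip) ∘ₗ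
    (DirectSum.decomposeLinearEquiv 𝒱).toLinearMap

theorem totalAct_lof (φ : ∀ α β, 𝒱 α →ₗ[k] C β →ₗ[k] C (α + β)) {α β : Γ} (x : 𝒱 α) (f : C β) :
    totalAct 𝒱 φ x (DirectSum.lof k Γ C β f) = DirectSum.lof k Γ C (α + β) (φ α β x f) := by
  simp [totalAct]

/-- The homogeneous subspaces of `⨁ C_β`. -/
def totalDeg (k : Type*) [Field k] {Γ : Type*} [DecidableEq Γ] (C : Γ → Type*)
    [∀ β, AddCommGroup (C β)] [∀ β, Module k (C β)] (β : Γ) : Submodule k (⨁ β, C β) :=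
  LinearMap.range (DirectSum.lof k Γ C β)

end Total

section Lie

variable {Γ k : Type*} [AddCommGroup Γ] [DecidableEq Γ] [Field k] {ε : CommutationFactor Γ k}
variable {V W : Type*} [AddCommGroup V] [Module k V] [AddCommGroup W] [Module k W]
variable {𝒱 : Γ → Submodule k V} [DirectSum.Decomposition 𝒱] {𝒲 : Γ → Submodule k W}

/-- The bracket of homogeneous elements, with its degree. -/
def EpsLieAlgebra.brHom (𝔤 : EpsLieAlgebra ε 𝒱) (a b : (α : Γ) × 𝒱 α) : (α : Γ) × 𝒱 α :=
  ⟨a.1 + b.1, ⟨𝔤.bracket a.2 b.2, 𝔤.bracket_mem a.2.2 b.2.2⟩⟩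

theorem val_update {Γ k V : Type*} [Field k] [AddCommGroup V] [Module k V]
    {𝒱 : Γ → Submodule k V} {n : ℕ} (e : Fin n → (α : Γ) × 𝒱 α) (j : Fin n) (a : (α : Γ) × 𝒱 α) :
    (fun s => ((Function.update e j a s).2 : V)) =
      Function.update (fun s => ((e s).2 : V)) j (a.2 : V) := by
  funext s
  rcases eq_or_ne s j with rfl | hs
  · rw [Function.update_self, Function.update_self]
  · rw [Function.update_of_ne hs, Function.update_of_ne hs]

namespace EpsLieModule

variable {𝔤 : EpsLieAlgebra ε 𝒱} (𝔐 : EpsLieModule 𝔤 𝒲)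

/-- The coboundary of a multilinear map of degree `β`: on homogeneous `x_s` of degree `α_s`,
`(𝔡f)(x_0, …, x_n)` is the sum over `t` of `(-1)^t` times
`ε(β + α_0 + ⋯ + α_{t-1}, α_t) [x_t, f(x_0, …, x̂_t, …, x_n)]
  - ∑_{j > t} ε(α_t, α_{t+1} + ⋯ + α_{j-1}) f(x_0, …, x̂_t, …, [x_t, x_j], …, x_n)`. -/
noncomputable def coboundMap {n : ℕ} (β : Γ) (f : MultilinearMap k (fun _ : Fin n => V) W) :
    MultilinearMap k (fun _ : Fin (n + 1) => V) W :=
  gradedMultiLift 𝒱 fun α => ∑ t : Fin (n + 1), (-1 : k) ^ (t : ℕ) •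
    (ε (β + ∑ s with s < t, α s) (α t) • insertAct 𝔐.act f t -
      ∑ j : Fin n with t < t.succAbove j,
        ε (α t) (∑ s with t < s ∧ s < t.succAbove j, α s) • insertBracket 𝔤.bracket f t j)

theorem coboundMap_apply {n : ℕ} (β : Γ) (f : MultilinearMap k (fun _ : Fin n => V) W)
    {α : Fin (n + 1) → Γ} {x : Fin (n + 1) → V} (hx : ∀ s, x s ∈ 𝒱 (α s)) :
    𝔐.coboundMap β f x = ∑ t : Fin (n + 1), (-1 : k) ^ (t : ℕ) •
      (ε (β + ∑ s with s < t, α s) (α t) • 𝔐.act (x t) (f (t.removeNth x)) -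
        ∑ j : Fin n with t < t.succAbove j,
          ε (α t) (∑ s with t < s ∧ s < t.succAbove j, α s) •
            f (Function.update (t.removeNth x) j (𝔤.bracket (x t) (x (t.succAbove j))))) := by
  rw [coboundMap, gradedMultiLift_apply 𝒱 _ hx]
  simp only [sum_apply, smul_apply, sub_apply,
    insertAct_apply, insertBracket_apply]

theorem coboundMap_eq_tuple {n : ℕ} (β : Γ) (f : MultilinearMap k (fun _ : Fin n => V) W)
    (e : Fin (n + 1) → (α : Γ) × 𝒱 α) :
    𝔐.coboundMap β f (fun s => (e s).2) = tupleCobound ε Sigma.fst 𝔤.brHom β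
      (fun u y => 𝔐.act u.2 (f fun s => (y s).2)) (fun y => f fun s => (y s).2) e := by
  rw [𝔐.coboundMap_apply β f (fun s => (e s).2.2)]
  simp only [tupleCobound, val_update]
  rfl

theorem coboundMap_mem {n : ℕ} {β : Γ} {f : MultilinearMap k (fun _ : Fin n => V) W}
    (hf : f ∈ cochains ε 𝒱 𝒲 n n β) : 𝔐.coboundMap β f ∈ cochains ε 𝒱 𝒲 (n + 1) (n + 1) β := by
  intro α x hx
  constructor
  · rw [𝔐.coboundMap_apply β f hx]
    refine Submodule.sum_mem _ fun t _ => Submodule.smul_mem _ _ (Submodule.sub_mem _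
      (Submodule.smul_mem _ _ ?_) (Submodule.sum_mem _ fun j _ => Submodule.smul_mem _ _ ?_))
    · have := 𝔐.isModule.act_mem (hx t)
        (hf (t.removeNth α) (t.removeNth x) (fun s => hx _)).1
      convert this using 2
      rw [Fin.sum_univ_succAbove _ t]
      simp only [Fin.removeNth_apply]
      abel
    · refine map_mem_of_update (α := t.removeNth α) hf (fun s => hx _) j
        (𝔤.bracket_mem (hx t) (hx _)) ?_
      rw [Fin.sum_univ_succAbove _ t]
      simp only [Fin.removeNth_apply]
      abel
  · intro p q hpq _
    have hF : TupleSkew ε Sigma.fst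
        (fun y : Fin n → (α : Γ) × 𝒱 α => f fun s => (y s).2) := fun y p q hpq =>
      (hf (fun s => (y s).1) (fun s => (y s).2) (fun s => (y s).2.2)).2 p q hpq q.2
    have key := tupleSkew_tupleCobound (ε := ε) (deg := Sigma.fst) (br := 𝔤.brHom)
      (fun _ _ => rfl) β (P := fun u y => 𝔐.act u.2 (f fun s => (y s).2))
      (F := fun y => f fun s => (y s).2)
      (fun u y p q hpq => by
        have := congrArg (𝔐.act u.2) (hF y p q hpq)
        simpa using this) hF
      (fun y j a b => by
        have hs := eq_neg_of_add_eq_zero_left (𝔤.skew a.2.2 b.2.2)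
        simp only [val_update, EpsLieAlgebra.brHom]
        rw [hs, ← neg_smul, f.map_update_smul, neg_smul])
      (fun s => ⟨α s, x s, hx s⟩) p q hpq
    rw [← 𝔐.coboundMap_eq_tuple, ← 𝔐.coboundMap_eq_tuple] at key
    exact key

/-- The coboundary on cochains of degree `β`. -/
noncomputable def dDeg (n : ℕ) (β : Γ) :
    CochainSpace ε 𝒱 𝒲 n n β →ₗ[k] CochainSpace ε 𝒱 𝒲 (n + 1) (n + 1) β where
  toFun f := .mk (𝔐.coboundMap β f.map) (𝔐.coboundMap_mem f.map_mem)
  map_add' f g := by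
    refine CochainSpace.ext ?_
    refine multilinearMap_ext_of_homogeneous 𝒱 fun α x hx => ?_
    simp only [CochainSpace.map_mk, CochainSpace.map_add, add_apply, 𝔐.coboundMap_apply β _ hx, map_add,
      ← Finset.sum_add_distrib]
    refine Finset.sum_congr rfl fun t _ => ?_
    simp only [smul_add, Finset.sum_add_distrib]
    module
  map_smul' c f := by
    refine CochainSpace.ext ?_
    refine multilinearMap_ext_of_homogeneous 𝒱 fun α x hx => ?_
    simp only [CochainSpace.map_mk, CochainSpace.map_smul, smul_apply, 𝔐.coboundMap_apply β _ hx, map_smul,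
      Finset.smul_sum, RingHom.id_apply]
    refine Finset.sum_congr rfl fun t _ => ?_
    simp only [smul_comm _ c, ← Finset.smul_sum, ← smul_sub]

/-- The action of an element `u` of degree `α` on a multilinear map of degree `β`:
`(ξ(u)f)(x_1, …, x_n) = [u, f(x_1, …, x_n)]
  - ∑_j ε(α, β + α_1 + ⋯ + α_{j-1}) f(x_1, …, [u, x_j], …, x_n)`. -/
noncomputable def actMap {n : ℕ} (α β : Γ) (u : V) (f : MultilinearMap k (fun _ : Fin n => V) W) :
    MultilinearMap k (fun _ : Fin n => V) W :=
  gradedMultiLift 𝒱 fun γ => (𝔐.act u).compMultilinearMap f -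
    ∑ j : Fin n, ε α (β + ∑ s with s < j, γ s) • applyAt (𝔤.bracket u) f j

theorem actMap_apply {n : ℕ} (α β : Γ) (u : V) (f : MultilinearMap k (fun _ : Fin n => V) W)
    {γ : Fin n → Γ} {x : Fin n → V} (hx : ∀ s, x s ∈ 𝒱 (γ s)) :
    𝔐.actMap α β u f x = 𝔐.act u (f x) -
      ∑ j : Fin n, ε α (β + ∑ s with s < j, γ s) •
        f (Function.update x j (𝔤.bracket u (x j))) := by
  rw [actMap, gradedMultiLift_apply 𝒱 _ hx]
  simp only [sum_apply, smul_apply, sub_apply,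
    applyAt_apply, LinearMap.compMultilinearMap_apply]

theorem actMap_mem {n : ℕ} {α β : Γ} {u : V} (hu : u ∈ 𝒱 α)
    {f : MultilinearMap k (fun _ : Fin n => V) W}
    (hf : f ∈ cochains ε 𝒱 𝒲 n n β) : 𝔐.actMap α β u f ∈ cochains ε 𝒱 𝒲 n n (α + β) := by
  intro γ x hx
  constructor
  · rw [𝔐.actMap_apply α β u f hx]
    refine Submodule.sub_mem _ ?_ (Submodule.sum_mem _ fun j _ => Submodule.smul_mem _ _ ?_)
    · have := 𝔐.isModule.act_mem hu (hf γ x hx).1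
      rwa [← add_assoc] at this
    · refine map_mem_of_update hf hx j (𝔤.bracket_mem hu (hx _)) ?_
      abel
  · intro p q hpq _
    have hF : TupleSkew ε Sigma.fst
        (fun y : Fin n → (α : Γ) × 𝒱 α => f fun s => (y s).2) := fun y p q hpq =>
      (hf (fun s => (y s).1) (fun s => (y s).2) (fun s => (y s).2.2)).2 p q hpq q.2
    have eq : ∀ e : Fin n → (α : Γ) × 𝒱 α, 𝔐.actMap α β u f (fun s => (e s).2) =
        𝔐.act u (f fun s => (e s).2) - ε α β • tupleAct ε Sigma.fst 𝔤.brHom ⟨α, u, hu⟩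
          (fun y => f fun s => (y s).2) e := by
      intro e
      rw [𝔐.actMap_apply α β u f (fun s => (e s).2.2)]
      simp only [tupleAct, val_update, ε.add_right, Finset.smul_sum, smul_smul]
      rfl
    have key := tupleSkew_tupleAct (ε := ε) (deg := Sigma.fst) (br := 𝔤.brHom)
      (fun _ _ => rfl) ⟨α, u, hu⟩ hF (fun s => ⟨γ s, x s, hx s⟩) p q hpq
    have h1 := hF (fun s => ⟨γ s, x s, hx s⟩) p q hpq
    have e1 := eq (fun s => ⟨γ s, x s, hx s⟩)
    have e2 := eq ((fun s => ⟨γ s, x s, hx s⟩) ∘ Equiv.swap p q)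
    refine e1.trans ?_
    have h1' := congrArg (𝔐.act u) h1
    have e2' := congrArg (fun w => -(ε (γ p) (γ q) • w)) e2
    refine Eq.trans ?_ e2'.symm
    rw [key]
    rw [map_neg, map_smul] at h1'
    refine (congrArg (· - _) h1').trans ?_
    dsimp only
    simp only [smul_sub, neg_sub, smul_neg, smul_smul, sub_neg_eq_add, mul_comm]
    abel

/-- The action of `𝔤_α` on cochains of degree `β`. -/
noncomputable def actDeg (n : ℕ) (α β : Γ) :
    𝒱 α →ₗ[k] CochainSpace ε 𝒱 𝒲 n n β →ₗ[k] CochainSpace ε 𝒱 𝒲 n n (α + β) :=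
  LinearMap.mk₂ k (fun u f => .mk (𝔐.actMap α β u f.map) (𝔐.actMap_mem u.2 f.map_mem))
    (fun u v f => by
      refine CochainSpace.ext ?_
      refine multilinearMap_ext_of_homogeneous 𝒱 fun γ x hx => ?_
      simp only [CochainSpace.map_mk, CochainSpace.map_add, Submodule.coe_add, add_apply, 𝔐.actMap_apply α β _ _ hx, map_add,
        LinearMap.add_apply, MultilinearMap.map_update_add, smul_add, Finset.sum_add_distrib]
      abel)
    (fun c u f => by
      refine CochainSpace.ext ?_
      refine multilinearMap_ext_of_homogeneous 𝒱 fun γ x hx => ?_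
      simp only [CochainSpace.map_mk, CochainSpace.map_smul, Submodule.coe_smul, smul_apply, 𝔐.actMap_apply α β _ _ hx,
        map_smul, LinearMap.smul_apply, MultilinearMap.map_update_smul, smul_comm _ c,
        ← Finset.smul_sum, ← smul_sub])
    (fun u f g => by
      refine CochainSpace.ext ?_
      refine multilinearMap_ext_of_homogeneous 𝒱 fun γ x hx => ?_
      simp only [CochainSpace.map_mk, CochainSpace.map_add, add_apply, 𝔐.actMap_apply α β _ _ hx, map_add,
        smul_add, Finset.sum_add_distrib]
      abel)
    (fun c u f => by
      refine CochainSpace.ext ?_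
      refine multilinearMap_ext_of_homogeneous 𝒱 fun γ x hx => ?_
      simp only [CochainSpace.map_mk, CochainSpace.map_smul, smul_apply, 𝔐.actMap_apply α β _ _ hx,
        map_smul, smul_comm _ c, ← Finset.smul_sum, ← smul_sub])

/-- `C^n(𝔤, 𝔐) = ⨁_β Hom_β(⋀_ε^n 𝔤, 𝔐)`. -/
abbrev Cochain (_ : EpsLieModule 𝔤 𝒲) (n : ℕ) : Type _ := ⨁ β, CochainSpace ε 𝒱 𝒲 n n β

/-- The grading of `C^n(𝔤, 𝔐)`. -/
abbrev cochainDeg (n : ℕ) : Γ → Submodule k (𝔐.Cochain n) :=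
  totalDeg k (fun β => CochainSpace ε 𝒱 𝒲 n n β)

/-- The coboundary operator `𝔡 : C^n(𝔤, 𝔐) → C^{n+1}(𝔤, 𝔐)`. -/
noncomputable def d (n : ℕ) : 𝔐.Cochain n →ₗ[k] 𝔐.Cochain (n + 1) :=
  DirectSum.lmap fun β => 𝔐.dDeg n β

/-- The representation `ξ` of `𝔤` on `C^n(𝔤, 𝔐)`. -/
noncomputable def cochainAct (n : ℕ) : V →ₗ[k] 𝔐.Cochain n →ₗ[k] 𝔐.Cochain n :=
  totalAct 𝒱 fun α β => 𝔐.actDeg n α β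

/-- `Z^n(𝔤, 𝔐)`. -/
noncomputable def cocycles (n : ℕ) : Submodule k (𝔐.Cochain n) := LinearMap.ker (𝔐.d n)

/-- `B^n(𝔤, 𝔐)`. -/
noncomputable def coboundaries : (n : ℕ) → Submodule k (𝔐.Cochain n)
  | 0 => ⊥
  | n + 1 => LinearMap.range (𝔐.d n)

/-- `H^n_Lie(𝔤, 𝔐) = Z^n / B^n`. -/
abbrev Cohomology (n : ℕ) : Type _ :=
  𝔐.cocycles n ⧸ (𝔐.coboundaries n).submoduleOf (𝔐.cocycles n)

end EpsLieModule

end Lie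

section LeftSymmetric

variable {Γ k : Type*} [AddCommGroup Γ] [Field k] {ε : CommutationFactor Γ k}
variable {S M : Type*} [AddCommGroup S] [Module k S] [AddCommGroup M] [Module k M]
variable {𝒮 : Γ → Submodule k S} {ℳ : Γ → Submodule k M}

theorem comp_swap_castSucc {i : ℕ} {E : Type*} (x : Fin (i + 1) → E) (p q : Fin i) :
    x ∘ Equiv.swap p.castSucc q.castSucc =
      Fin.snoc (α := fun _ => E) (fun s => x (Equiv.swap p q s).castSucc) (x (Fin.last i)) := by
  funext s
  cases s using Fin.lastCases with
  | last => simp [Equiv.swap_apply_of_ne_of_ne (Fin.castSucc_lt_last p).ne'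
      (Fin.castSucc_lt_last q).ne']
  | cast s =>
    rw [Fin.snoc_castSucc, Function.comp_apply]
    congr 1
    simp only [Equiv.swap_apply_def, Fin.castSucc_inj]
    split_ifs <;> rfl

theorem tupleSkew_of_mem {i : ℕ} {β : Γ} {f : MultilinearMap k (fun _ : Fin (i + 1) => S) M}
    (hf : f ∈ cochains ε 𝒮 ℳ (i + 1) i β) (z : (α : Γ) × 𝒮 α) :
    TupleSkew ε Sigma.fst (fun y : Fin i → (α : Γ) × 𝒮 α =>
      f (Fin.snoc (α := fun _ => S) (fun s => ((y s).2 : S)) z.2)) := by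
  intro y p q hpq
  have hx : ∀ s, (Fin.snoc (α := fun _ => S) (fun s => ((y s).2 : S)) z.2 : Fin (i + 1) → S) s ∈
      𝒮 ((Fin.snoc (α := fun _ => Γ) (fun s => (y s).1) z.1 : Fin (i + 1) → Γ) s) := by
    intro s
    cases s using Fin.lastCases with
    | last => simp only [Fin.snoc_last]; exact z.2.2
    | cast s => simp only [Fin.snoc_castSucc]; exact (y s).2.2
  have h := (hf _ _ hx).2 p.castSucc q.castSucc hpq q.2
  rw [comp_swap_castSucc] at h
  simp only [Fin.snoc_castSucc, Fin.snoc_last] at h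
  exact h

theorem skew_of_tupleSkew {i : ℕ} {f : MultilinearMap k (fun _ : Fin (i + 1) => S) M}
    (h : ∀ z : (α : Γ) × 𝒮 α, TupleSkew ε Sigma.fst (fun y : Fin i → (α : Γ) × 𝒮 α =>
      f (Fin.snoc (α := fun _ => S) (fun s => ((y s).2 : S)) z.2)))
    {α : Fin (i + 1) → Γ} {x : Fin (i + 1) → S} (hx : ∀ s, x s ∈ 𝒮 (α s))
    {p q : Fin (i + 1)} (hpq : (p : ℕ) + 1 = q) (hq : (q : ℕ) < i) :
    f x = -(ε (α p) (α q) • f (x ∘ Equiv.swap p q)) := by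
  obtain ⟨p, rfl⟩ : ∃ p' : Fin i, p = p'.castSucc := ⟨⟨p, by omega⟩, rfl⟩
  obtain ⟨q, rfl⟩ : ∃ q' : Fin i, q = q'.castSucc := ⟨⟨q, by omega⟩, rfl⟩
  have key := h ⟨α (Fin.last i), x (Fin.last i), hx _⟩
    (fun s => ⟨α s.castSucc, x s.castSucc, hx _⟩) p q hpq
  rw [comp_swap_castSucc]
  have e : Fin.snoc (α := fun _ => S) (fun s : Fin i => x s.castSucc) (x (Fin.last i)) = x :=
    Fin.snoc_init_self x
  have key' := key
  simp only [e] at key'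
  exact key'

variable [DecidableEq Γ] [DirectSum.Decomposition 𝒮]

namespace Bimodule

variable {A : LeftSymmetricAlgebra ε 𝒮} (B : Bimodule A ℳ)

/-- The coboundary of a multilinear map of degree `β` in the variables `x_0, …, x_{i-1}, x_i`
(the last one is distinguished): on homogeneous `x_s` of degree `α_s`,
`(df)(x_0, …, x_i, x_{i+1})` is the sum over `t ≤ i` of `(-1)^t` times
`ε(β + α_0 + ⋯ + α_{t-1}, α_t) x_t · f(x_0, …, x̂_t, …, x_i, x_{i+1})
  - ε(α_t, α_{t+1} + ⋯ + α_i) f(x_0, …, x̂_t, …, x_i, x_t · x_{i+1})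
  + ε(α_t, α_{t+1} + ⋯ + α_i) f(x_0, …, x̂_t, …, x_i, x_t) · x_{i+1}
  - ∑_{t < j ≤ i} ε(α_t, α_{t+1} + ⋯ + α_{j-1}) f(x_0, …, x̂_t, …, [x_t, x_j], …, x_i, x_{i+1})`. -/
noncomputable def coboundMap {i : ℕ} (β : Γ)
    (f : MultilinearMap k (fun _ : Fin (i + 1) => S) M) :
    MultilinearMap k (fun _ : Fin (i + 1 + 1) => S) M :=
  gradedMultiLift 𝒮 fun α => ∑ t : Fin (i + 1), (-1 : k) ^ (t : ℕ) •
    (ε (β + ∑ s with s < t.castSucc, α s) (α t.castSucc) • insertAct B.left f t.castSucc -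
      ε (α t.castSucc) (∑ s with t.castSucc < s ∧ s < Fin.last (i + 1), α s) •
        insertBracket A.mul f t.castSucc (Fin.last i) +
      ε (α t.castSucc) (∑ s with t.castSucc < s ∧ s < Fin.last (i + 1), α s) •
        insertRight B.right f t.castSucc (Fin.last i) -
      ∑ j : Fin i with t < t.succAbove j,
        ε (α t.castSucc)
            (∑ s with t.castSucc < s ∧ s < (t.succAbove j).castSucc, α s) •
          insertBracket A.lie.bracket f t.castSucc j.castSucc)

theorem coboundMap_apply {i : ℕ} (β : Γ) (f : MultilinearMap k (fun _ : Fin (i + 1) => S) M)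
    {α : Fin (i + 1 + 1) → Γ} {x : Fin (i + 1 + 1) → S} (hx : ∀ s, x s ∈ 𝒮 (α s)) :
    B.coboundMap β f x = ∑ t : Fin (i + 1), (-1 : k) ^ (t : ℕ) •
    (ε (β + ∑ s with s < t.castSucc, α s) (α t.castSucc) •
        B.left (x t.castSucc) (f (t.castSucc.removeNth x)) -
      ε (α t.castSucc) (∑ s with t.castSucc < s ∧ s < Fin.last (i + 1), α s) •
        f (Function.update (t.castSucc.removeNth x) (Fin.last i)
          (A.mul (x t.castSucc) (x (Fin.last (i + 1))))) +
      ε (α t.castSucc) (∑ s with t.castSucc < s ∧ s < Fin.last (i + 1), α s) •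
        B.right (f (Function.update (t.castSucc.removeNth x) (Fin.last i) (x t.castSucc)))
          (x (Fin.last (i + 1))) -
      ∑ j : Fin i with t < t.succAbove j,
        ε (α t.castSucc)
            (∑ s with t.castSucc < s ∧ s < (t.succAbove j).castSucc, α s) •
          f (Function.update (t.castSucc.removeNth x) j.castSucc
            (A.lie.bracket (x t.castSucc) (x (t.succAbove j).castSucc)))) := by
  rw [coboundMap, gradedMultiLift_apply 𝒮 _ hx]
  have hl : ∀ t : Fin (i + 1), t.castSucc.succAbove (Fin.last i) = Fin.last (i + 1) :=
    fun t => by simp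
  simp only [sum_apply, smul_apply, sub_apply, add_apply,
    insertAct_apply, insertBracket_apply, insertRight_apply, hl, Fin.castSucc_succAbove_castSucc]

theorem coboundMap_eq_tuple {i : ℕ} (β : Γ) (f : MultilinearMap k (fun _ : Fin (i + 1) => S) M)
    (z : (α : Γ) × 𝒮 α) (e : Fin (i + 1) → (α : Γ) × 𝒮 α) :
    B.coboundMap β f (Fin.snoc (α := fun _ => S) (fun s => ((e s).2 : S)) z.2) =
      tupleCobound ε Sigma.fst A.lie.brHom β
      (fun u y =>
        B.left u.2 (f (Fin.snoc (α := fun _ => S) (fun s => ((y s).2 : S)) z.2)) -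
        ε u.1 (β + ∑ s, (y s).1) •
          (f (Fin.snoc (α := fun _ => S) (fun s => ((y s).2 : S)) (A.mul u.2 z.2)) -
          B.right (f (Fin.snoc (α := fun _ => S) (fun s => ((y s).2 : S)) u.2)) z.2))
      (fun y => f (Fin.snoc (α := fun _ => S) (fun s => ((y s).2 : S)) z.2)) e := by
  have hx : ∀ s, (Fin.snoc (α := fun _ => S) (fun s => ((e s).2 : S)) z.2 : Fin (i + 2) → S) s ∈
      𝒮 ((Fin.snoc (α := fun _ => Γ) (fun s => (e s).1) z.1 : Fin (i + 2) → Γ) s) := by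
    intro s
    cases s using Fin.lastCases with
    | last => simp only [Fin.snoc_last]; exact z.2.2
    | cast s => simp only [Fin.snoc_castSucc]; exact (e s).2.2
  rw [B.coboundMap_apply β f hx, tupleCobound]
  refine Finset.sum_congr rfl fun t _ => ?_
  have hr : t.castSucc.removeNth (Fin.snoc (α := fun _ => S) (fun s => ((e s).2 : S)) z.2 :
      Fin (i + 2) → S) = Fin.snoc (α := fun _ => S) (fun s => ((t.removeNth e s).2 : S)) z.2 := by
    funext s
    cases s using Fin.lastCases with
    | last => simp [Fin.removeNth]
    | cast s => simp [Fin.removeNth]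
  have s1 : (∑ s with s < t.castSucc, (Fin.snoc (α := fun _ => Γ) (fun s => (e s).1) z.1 :
      Fin (i + 2) → Γ) s) = ∑ s with s < t, (e s).1 := by
    rw [Finset.sum_filter, Fin.sum_univ_castSucc, Finset.sum_filter]
    simp [Fin.not_lt.2 (Fin.le_last _)]
  have s2 : (∑ s with t.castSucc < s ∧ s < Fin.last (i + 1),
      (Fin.snoc (α := fun _ => Γ) (fun s => (e s).1) z.1 : Fin (i + 2) → Γ) s) =
        ∑ s with t < s, (e s).1 := by
    rw [Finset.sum_filter, Fin.sum_univ_castSucc, Finset.sum_filter]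
    simp [Fin.castSucc_lt_last]
  have s3 : ∀ j : Fin i, (∑ s with t.castSucc < s ∧ s < (t.succAbove j).castSucc,
      (Fin.snoc (α := fun _ => Γ) (fun s => (e s).1) z.1 : Fin (i + 2) → Γ) s) =
        ∑ s with t < s ∧ s < t.succAbove j, (e s).1 := by
    intro j
    rw [Finset.sum_filter, Fin.sum_univ_castSucc, Finset.sum_filter]
    simp [Fin.not_lt.2 (Fin.le_last _)]
  have s4 : (∑ s, (t.removeNth e s).1) = (∑ s with s < t, (e s).1) + ∑ s with t < s, (e s).1 := by
    have h := Fin.sum_univ_succAbove (fun s => (e s).1) t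
    have h' : (∑ s, (e s).1) =
        (e t).1 + ((∑ s with s < t, (e s).1) + ∑ s with t < s, (e s).1) := by
      have h1 : ∀ s, (e s).1 = (if s = t then (e s).1 else 0) +
          ((if s < t then (e s).1 else 0) + if t < s then (e s).1 else 0) := by
        intro s
        rcases lt_trichotomy s t with h | h | h
        · simp [h, h.ne, h.not_gt]
        · simp [h]
        · simp [h, h.ne', h.not_gt]
      rw [Finset.sum_congr rfl fun s _ => h1 s, Finset.sum_add_distrib, Finset.sum_add_distrib]
      simp [Finset.sum_filter]
    exact add_left_cancel (h.symm.trans h')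
  simp only [hr, s1, s2, s3]
  simp only [Fin.snoc_castSucc, Fin.snoc_last, s4, Fin.update_snoc_last, ← Fin.snoc_update,
    val_update]
  have h1 := ε.mul_swap (∑ s with s < t, (e s).1) (e t).1
  have h2 := ε.mul_swap β (e t).1
  simp only [ε.add_left, ε.add_right, EpsLieAlgebra.brHom]
  congr 2
  match_scalars <;> grind

theorem coboundMap_mem {i : ℕ} {β : Γ} {f : MultilinearMap k (fun _ : Fin (i + 1) => S) M}
    (hf : f ∈ cochains ε 𝒮 ℳ (i + 1) i β) :
    B.coboundMap β f ∈ cochains ε 𝒮 ℳ (i + 1 + 1) (i + 1) β := by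
  intro α x hx
  constructor
  · rw [B.coboundMap_apply β f hx]
    have hx' : ∀ (t : Fin (i + 1)) s, t.castSucc.removeNth x s ∈ 𝒮 (t.castSucc.removeNth α s) :=
      fun t s => hx _
    have hs : ∀ t : Fin (i + 1), ∑ s, α s = α t.castSucc + ∑ s, t.castSucc.removeNth α s :=
      fun t => Fin.sum_univ_succAbove α t.castSucc
    have hl : ∀ t : Fin (i + 1), t.castSucc.removeNth α (Fin.last i) = α (Fin.last (i + 1)) :=
      fun t => by simp [Fin.removeNth_apply]
    have hj : ∀ (t : Fin (i + 1)) (j : Fin i),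
        t.castSucc.removeNth α j.castSucc = α (t.succAbove j).castSucc :=
      fun t j => by simp [Fin.removeNth_apply]
    refine Submodule.sum_mem _ fun t _ => Submodule.smul_mem _ _ (Submodule.sub_mem _
      (Submodule.add_mem _ (Submodule.sub_mem _ (Submodule.smul_mem _ _ ?_)
      (Submodule.smul_mem _ _ ?_)) (Submodule.smul_mem _ _ ?_))
      (Submodule.sum_mem _ fun j _ => Submodule.smul_mem _ _ ?_))
    · have := B.left_mem (hx t.castSucc) (hf _ _ (hx' t)).1
      convert this using 2
      rw [hs t]
      abel
    · refine map_mem_of_update hf (hx' t) _ (A.mul_mem (hx _) (hx _)) ?_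
      rw [hs t, hl]
      abel
    · have := B.right_mem (map_mem_of_update hf (hx' t) (Fin.last i) (hx t.castSucc)
        (μ := β + ∑ s, α s - α (Fin.last (i + 1))) (by rw [hs t, hl]; abel))
        (hx (Fin.last (i + 1)))
      rwa [sub_add_cancel] at this
    · refine map_mem_of_update hf (hx' t) _ (A.lie.bracket_mem (hx _) (hx _)) ?_
      rw [hs t, hj]
      abel
  · intro p q hpq hq
    refine skew_of_tupleSkew (fun z => ?_) hx hpq hq
    simp only [B.coboundMap_eq_tuple]
    refine tupleSkew_tupleCobound (fun _ _ => rfl) β (fun u y p q hpq => ?_)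
      (tupleSkew_of_mem hf z) (fun y j a b => ?_)
    · have h1 := tupleSkew_of_mem hf z y p q hpq
      have h2 := tupleSkew_of_mem hf ⟨_, _, A.mul_mem u.2.2 z.2.2⟩ y p q hpq
      have h3 := tupleSkew_of_mem hf u y p q hpq
      have h4 : (∑ s, ((y ∘ Equiv.swap p q) s).1) = ∑ s, (y s).1 :=
        Equiv.sum_comp (Equiv.swap p q) (fun s => (y s).1)
      dsimp only at h1 h2 h3 ⊢
      rw [h1, h2, h3, h4]
      simp only [map_neg, map_smul, LinearMap.neg_apply, LinearMap.smul_apply]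
      module
    · have hs := eq_neg_of_add_eq_zero_left (A.lie.skew a.2.2 b.2.2)
      simp only [val_update, EpsLieAlgebra.brHom, Fin.snoc_update]
      rw [hs, ← neg_smul, f.map_update_smul, neg_smul]

/-- The coboundary on cochains of degree `β`. -/
noncomputable def dDeg (i : ℕ) (β : Γ) :
    CochainSpace ε 𝒮 ℳ (i + 1) i β →ₗ[k] CochainSpace ε 𝒮 ℳ (i + 1 + 1) (i + 1) β where
  toFun f := .mk (B.coboundMap β f.map) (B.coboundMap_mem f.map_mem)
  map_add' f g := by
    refine CochainSpace.ext (multilinearMap_ext_of_homogeneous 𝒮 fun α x hx => ?_)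
    simp only [CochainSpace.map_mk, CochainSpace.map_add, add_apply,
      B.coboundMap_apply β _ hx, map_add, LinearMap.add_apply, ← Finset.sum_add_distrib]
    refine Finset.sum_congr rfl fun t _ => ?_
    simp only [smul_add, Finset.sum_add_distrib]
    module
  map_smul' c f := by
    refine CochainSpace.ext (multilinearMap_ext_of_homogeneous 𝒮 fun α x hx => ?_)
    simp only [CochainSpace.map_mk, CochainSpace.map_smul, smul_apply,
      B.coboundMap_apply β _ hx, map_smul, LinearMap.smul_apply, Finset.smul_sum,
      RingHom.id_apply]
    refine Finset.sum_congr rfl fun t _ => ?_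
    simp only [smul_comm _ c, ← Finset.smul_sum, ← smul_sub, ← smul_add]

/-- The action of an element `u` of degree `α` on a multilinear map of degree `β` in the
variables `x_1, …, x_i, x_{i+1}`:
`(ρ(u)f)(x_1, …, x_i, x_{i+1}) = u · f(x_1, …, x_i, x_{i+1})
  - ε(α, β + α_1 + ⋯ + α_i) f(x_1, …, x_i, u · x_{i+1})
  + ε(α, β + α_1 + ⋯ + α_i) f(x_1, …, x_i, u) · x_{i+1}
  - ∑_{j ≤ i} ε(α, β + α_1 + ⋯ + α_{j-1}) f(x_1, …, [u, x_j], …, x_i, x_{i+1})`. -/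
noncomputable def actMap {i : ℕ} (α β : Γ) (u : S)
    (f : MultilinearMap k (fun _ : Fin (i + 1) => S) M) :
    MultilinearMap k (fun _ : Fin (i + 1) => S) M :=
  gradedMultiLift 𝒮 fun γ => (B.left u).compMultilinearMap f -
    ε α (β + ∑ s with s < Fin.last i, γ s) • applyAt (A.mul u) f (Fin.last i) +
    ε α (β + ∑ s with s < Fin.last i, γ s) • replaceAt B.right u f (Fin.last i) -
    ∑ j : Fin i, ε α (β + ∑ s with s < j.castSucc, γ s) •
      applyAt (A.lie.bracket u) f j.castSucc

theorem actMap_apply {i : ℕ} (α β : Γ) (u : S)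
    (f : MultilinearMap k (fun _ : Fin (i + 1) => S) M)
    {γ : Fin (i + 1) → Γ} {x : Fin (i + 1) → S} (hx : ∀ s, x s ∈ 𝒮 (γ s)) :
    B.actMap α β u f x = B.left u (f x) -
      ε α (β + ∑ s with s < Fin.last i, γ s) •
        f (Function.update x (Fin.last i) (A.mul u (x (Fin.last i)))) +
      ε α (β + ∑ s with s < Fin.last i, γ s) •
        B.right (f (Function.update x (Fin.last i) u)) (x (Fin.last i)) -
      ∑ j : Fin i, ε α (β + ∑ s with s < j.castSucc, γ s) •
        f (Function.update x j.castSucc (A.lie.bracket u (x j.castSucc))) := by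
  rw [actMap, gradedMultiLift_apply 𝒮 _ hx]
  simp only [sum_apply, smul_apply, sub_apply, add_apply,
    applyAt_apply, replaceAt_apply, LinearMap.compMultilinearMap_apply]

theorem actMap_mem {i : ℕ} {α β : Γ} {u : S} (hu : u ∈ 𝒮 α)
    {f : MultilinearMap k (fun _ : Fin (i + 1) => S) M}
    (hf : f ∈ cochains ε 𝒮 ℳ (i + 1) i β) :
    B.actMap α β u f ∈ cochains ε 𝒮 ℳ (i + 1) i (α + β) := by
  intro γ x hx
  constructor
  · rw [B.actMap_apply α β u f hx]
    refine Submodule.sub_mem _ (Submodule.add_mem _ (Submodule.sub_mem _ ?_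
      (Submodule.smul_mem _ _ ?_)) (Submodule.smul_mem _ _ ?_))
      (Submodule.sum_mem _ fun j _ => Submodule.smul_mem _ _ ?_)
    · have := B.left_mem hu (hf γ x hx).1
      rwa [← add_assoc] at this
    · refine map_mem_of_update hf hx _ (A.mul_mem hu (hx _)) ?_
      abel
    · have := B.right_mem (map_mem_of_update hf hx (Fin.last i) hu
        (μ := α + β + ∑ s, γ s - γ (Fin.last i)) (by abel)) (hx (Fin.last i))
      rwa [sub_add_cancel] at this
    · refine map_mem_of_update hf hx _ (A.lie.bracket_mem hu (hx _)) ?_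
      abel
  · intro p q hpq hq
    refine skew_of_tupleSkew (fun z => ?_) hx hpq hq
    have eq : ∀ e : Fin i → (α : Γ) × 𝒮 α,
        B.actMap α β u f (Fin.snoc (α := fun _ => S) (fun s => ((e s).2 : S)) z.2) =
        B.left u (f (Fin.snoc (α := fun _ => S) (fun s => ((e s).2 : S)) z.2)) -
        ε α (β + ∑ s, (e s).1) •
          (f (Fin.snoc (α := fun _ => S) (fun s => ((e s).2 : S)) (A.mul u z.2)) -
          B.right (f (Fin.snoc (α := fun _ => S) (fun s => ((e s).2 : S)) u)) z.2) -
        ε α β • tupleAct ε Sigma.fst A.lie.brHom ⟨α, u, hu⟩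
          (fun y => f (Fin.snoc (α := fun _ => S) (fun s => ((y s).2 : S)) z.2)) e := by
      intro e
      have hx : ∀ s, (Fin.snoc (α := fun _ => S) (fun s => ((e s).2 : S)) z.2 :
          Fin (i + 1) → S) s ∈
          𝒮 ((Fin.snoc (α := fun _ => Γ) (fun s => (e s).1) z.1 : Fin (i + 1) → Γ) s) := by
        intro s
        cases s using Fin.lastCases with
        | last => simp only [Fin.snoc_last]; exact z.2.2
        | cast s => simp only [Fin.snoc_castSucc]; exact (e s).2.2
      rw [B.actMap_apply α β u f hx]
      have s1 : ∀ t : Fin i, (∑ s with s < t.castSucc, (Fin.snoc (α := fun _ => Γ)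
          (fun s => (e s).1) z.1 : Fin (i + 1) → Γ) s) = ∑ s with s < t, (e s).1 := by
        intro t
        rw [Finset.sum_filter, Fin.sum_univ_castSucc, Finset.sum_filter]
        simp [Fin.not_lt.2 (Fin.le_last _)]
      have s2 : (∑ s with s < Fin.last i, (Fin.snoc (α := fun _ => Γ)
          (fun s => (e s).1) z.1 : Fin (i + 1) → Γ) s) = ∑ s, (e s).1 := by
        rw [Finset.sum_filter, Fin.sum_univ_castSucc]
        simp [Fin.castSucc_lt_last]
      simp only [s1, s2, tupleAct, val_update, ε.add_right, Finset.smul_sum, smul_smul,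
        Fin.snoc_castSucc, Fin.snoc_last, Fin.update_snoc_last, ← Fin.snoc_update,
        EpsLieAlgebra.brHom]
      module
    intro y p q hpq
    have h0 := tupleSkew_tupleAct (ε := ε) (deg := Sigma.fst) (br := A.lie.brHom)
      (fun _ _ => rfl) ⟨α, u, hu⟩ (tupleSkew_of_mem hf z) y p q hpq
    have h1 := tupleSkew_of_mem hf z y p q hpq
    have h2 := tupleSkew_of_mem hf ⟨_, _, A.mul_mem hu z.2.2⟩ y p q hpq
    have h3 := tupleSkew_of_mem hf ⟨α, u, hu⟩ y p q hpq
    have h4 : (∑ s, ((y ∘ Equiv.swap p q) s).1) = ∑ s, (y s).1 :=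
      Equiv.sum_comp (Equiv.swap p q) (fun s => (y s).1)
    simp only [eq]
    dsimp only at h1 h2 h3
    rw [h0, h1, h2, h3, h4]
    simp only [map_neg, map_smul, LinearMap.neg_apply, LinearMap.smul_apply]
    module

/-- The action of `S_α` on cochains of degree `β`. -/
noncomputable def actDeg (i : ℕ) (α β : Γ) :
    𝒮 α →ₗ[k] CochainSpace ε 𝒮 ℳ (i + 1) i β →ₗ[k] CochainSpace ε 𝒮 ℳ (i + 1) i (α + β) :=
  LinearMap.mk₂ k (fun u f => .mk (B.actMap α β u f.map) (B.actMap_mem u.2 f.map_mem))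
    (fun u v f => by
      refine CochainSpace.ext (multilinearMap_ext_of_homogeneous 𝒮 fun γ x hx => ?_)
      simp only [CochainSpace.map_mk, CochainSpace.map_add, Submodule.coe_add, add_apply,
        B.actMap_apply α β _ _ hx, map_add, LinearMap.add_apply, MultilinearMap.map_update_add,
        smul_add, Finset.sum_add_distrib]
      abel)
    (fun c u f => by
      refine CochainSpace.ext (multilinearMap_ext_of_homogeneous 𝒮 fun γ x hx => ?_)
      simp only [CochainSpace.map_mk, CochainSpace.map_smul, Submodule.coe_smul, smul_apply,
        B.actMap_apply α β _ _ hx, map_smul, LinearMap.smul_apply,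
        MultilinearMap.map_update_smul, smul_comm _ c, ← Finset.smul_sum, ← smul_sub, ← smul_add])
    (fun u f g => by
      refine CochainSpace.ext (multilinearMap_ext_of_homogeneous 𝒮 fun γ x hx => ?_)
      simp only [CochainSpace.map_mk, CochainSpace.map_add, add_apply,
        B.actMap_apply α β _ _ hx, map_add, LinearMap.add_apply, smul_add,
        Finset.sum_add_distrib]
      abel)
    (fun c u f => by
      refine CochainSpace.ext (multilinearMap_ext_of_homogeneous 𝒮 fun γ x hx => ?_)
      simp only [CochainSpace.map_mk, CochainSpace.map_smul, smul_apply,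
        B.actMap_apply α β _ _ hx, map_smul, LinearMap.smul_apply, smul_comm _ c,
        ← Finset.smul_sum, ← smul_sub, ← smul_add])

/-- `C^{i+1}(S, M) = ⨁_β Hom_β(⋀_ε^i S ⊗ S, M)`. -/
abbrev Cochain (_ : Bimodule A ℳ) (i : ℕ) : Type _ := ⨁ β, CochainSpace ε 𝒮 ℳ (i + 1) i β

/-- The grading of `C^{i+1}(S, M)`. -/
abbrev cochainDeg (i : ℕ) : Γ → Submodule k (B.Cochain i) :=
  totalDeg k (fun β => CochainSpace ε 𝒮 ℳ (i + 1) i β)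

/-- The coboundary operator `d : C^{i+1}(S, M) → C^{i+2}(S, M)`. -/
noncomputable def d (i : ℕ) : B.Cochain i →ₗ[k] B.Cochain (i + 1) :=
  DirectSum.lmap fun β => B.dDeg i β

/-- The representation `ρ` of `𝔤_S` on `C^{i+1}(S, M)`. -/
noncomputable def cochainAct (i : ℕ) : S →ₗ[k] B.Cochain i →ₗ[k] B.Cochain i :=
  totalAct 𝒮 fun α β => B.actDeg i α β

/-- `C⁰(S, M) ∩ M_β`, where `C⁰(S, M) = {m ∈ M | (a · b) · m = a · (b · m) for all a, b ∈ S}`. -/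
def zeroCochains (β : Γ) : Submodule k M where
  carrier := {m | m ∈ ℳ β ∧ ∀ a b : S, B.left (A.mul a b) m = B.left a (B.left b m)}
  add_mem' hm hn := ⟨Submodule.add_mem _ hm.1 hn.1, fun a b => by
    simp only [map_add, hm.2 a b, hn.2 a b]⟩
  zero_mem' := ⟨Submodule.zero_mem _, fun a b => by simp⟩
  smul_mem' c m hm := ⟨Submodule.smul_mem _ c hm.1, fun a b => by simp only [map_smul, hm.2 a b]⟩

/-- The coboundary of `m ∈ C⁰(S, M) ∩ M_β`: `(dm)(x) = ε(β, α) x · m - m · x` for `x ∈ S_α`. -/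
noncomputable def dZeroMap (β : Γ) (m : M) : MultilinearMap k (fun _ : Fin (0 + 1) => S) M :=
  LinearMap.compMultilinearMap (gradedLift 𝒮 fun α => ε β α • B.left.flip m - B.right m)
    (MultilinearMap.ofSubsingleton k S S (0 : Fin 1) LinearMap.id)

theorem dZeroMap_apply (β : Γ) (m : M) {α : Γ} {x : Fin (0 + 1) → S} (hx : x 0 ∈ 𝒮 α) :
    B.dZeroMap β m x = ε β α • B.left (x 0) m - B.right m (x 0) := by
  have h : B.dZeroMap β m x =
      gradedLift 𝒮 (fun α => ε β α • B.left.flip m - B.right m) (x 0) := rfl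
  rw [h, gradedLift_apply 𝒮 _ hx]
  simp

/-- The coboundary operator on `C⁰(S, M) ∩ M_β`. -/
noncomputable def dZeroDeg (β : Γ) : B.zeroCochains β →ₗ[k] CochainSpace ε 𝒮 ℳ (0 + 1) 0 β where
  toFun m := .mk (B.dZeroMap β m) (by
    intro α x hx
    refine ⟨?_, fun p q _ hq => by omega⟩
    rw [B.dZeroMap_apply β _ (hx 0)]
    refine Submodule.sub_mem _ (Submodule.smul_mem _ _ ?_) ?_
    · have := B.left_mem (hx 0) m.2.1
      simpa [add_comm] using this
    · have := B.right_mem m.2.1 (hx 0)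
      simpa using this)
  map_add' m m' := by
    refine CochainSpace.ext (multilinearMap_ext_of_homogeneous 𝒮 fun γ x hx => ?_)
    change B.dZeroMap β (m + m' : M) x = B.dZeroMap β m x + B.dZeroMap β m' x
    simp only [B.dZeroMap_apply β _ (hx 0), map_add, LinearMap.add_apply]
    module
  map_smul' c m := by
    refine CochainSpace.ext (multilinearMap_ext_of_homogeneous 𝒮 fun γ x hx => ?_)
    change B.dZeroMap β (c • m : M) x = c • B.dZeroMap β m x
    simp only [B.dZeroMap_apply β _ (hx 0), map_smul, LinearMap.smul_apply]
    module

/-- The coboundary operator `d : C⁰(S, M) → C¹(S, M)`. -/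
noncomputable def dZero : (⨁ β, B.zeroCochains β) →ₗ[k] B.Cochain 0 :=
  DirectSum.lmap fun β => B.dZeroDeg β

/-- `Z^{i+1}(S, M)`. -/
noncomputable def cocycles (i : ℕ) : Submodule k (B.Cochain i) := LinearMap.ker (B.d i)

/-- `B^{i+1}(S, M)`. -/
noncomputable def coboundaries : (i : ℕ) → Submodule k (B.Cochain i)
  | 0 => LinearMap.range B.dZero
  | i + 1 => LinearMap.range (B.d i)

/-- `H^{i+1}(S, M) = Z^{i+1} / B^{i+1}`. -/
abbrev Cohomology (i : ℕ) : Type _ :=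
  B.cocycles i ⧸ (B.coboundaries i).submoduleOf (B.cocycles i)

section Psi

variable [DirectSum.Decomposition ℳ] [FiniteDimensional k S] [FiniteDimensional k M]

/-- `ψ` on cochains of degree `β`:
`ψ(f)(x_1, …, x_i, x_{i+1}) = f(x_1, …, x_i)(x_{i+1})`. -/
noncomputable def psiDeg (i : ℕ) (β : Γ) :
    CochainSpace ε 𝒮 (homDeg 𝒮 ℳ) i i β →ₗ[k] CochainSpace ε 𝒮 ℳ (i + 1) i β where
  toFun f := .mk (MultilinearMap.uncurryRight (M := fun _ : Fin (i + 1) => S) f.map) (by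
    intro α x hx
    constructor
    · have := ((f.map_mem (Fin.init α) (Fin.init x) (fun s => hx _)).1) _ _ (hx (Fin.last i))
      rw [Fin.sum_univ_castSucc, ← add_assoc]
      exact this
    · intro p q hpq hq
      refine skew_of_tupleSkew (fun z y p q hpq => ?_) hx hpq hq
      have := (f.map_mem (fun s => (y s).1) (fun s => (y s).2) (fun s => (y s).2.2)).2 p q hpq q.2
      have h := congrArg (fun g : S →ₗ[k] M => g z.2) this
      simp only [MultilinearMap.uncurryRight_apply, Fin.init_snoc, Fin.snoc_last]
      exact h)
  map_add' f g := rfl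
  map_smul' c f := rfl

/-- `ψ : C^i(𝔤_S, C¹(S, M)) → C^{i+1}(S, M)`. -/
noncomputable def psi (i : ℕ) : B.homModule.Cochain i →ₗ[k] B.Cochain i :=
  DirectSum.lmap fun β => psiDeg (ε := ε) (𝒮 := 𝒮) (ℳ := ℳ) i β

end Psi

end Bimodule

end LeftSymmetric

end GLSA

/-!
Let `ι_a` fix the first argument of a cochain to be `a` (`curryLeft`), let `L_u` be the action of
`u` (`actMap`) and let `d` be the coboundary operator. Up to commutation factors,
`ι_a L_u = L_u ι_a - ι_{[u, a]}` and, by Cartan's formula, `ι_a d = L_a - d ι_a`. Since a cochain is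
determined by its contractions, these two relations yield, successively and each by induction on
the number of arguments, `L_{[u, v]} = L_u L_v - L_v L_u`, `L_u d = d L_u` and `d² = 0` on the
cochains of an arbitrary `ε`-Lie module.

The map `ψ` uncurries the last argument and is inverted by currying it. The action on `C¹(S, M)` is
exactly what the operators of `C(S, M)` do to the last argument, so `ψ` intertwines both
representations and both coboundary operators. The module structure on `C(S, M)`, the relation
`d² = 0` there and the isomorphism in cohomology are then carried over along `ψ`.
-/

namespace GLSA

theorem multilinearMap_ext_of_curryLeft {Γ k V W : Type*} [DecidableEq Γ] [Field k]
    [AddCommGroup V] [Module k V] [AddCommGroup W] [Module k W]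
    (𝒱 : Γ → Submodule k V) [DirectSum.Decomposition 𝒱] {n : ℕ}
    {f g : MultilinearMap k (fun _ : Fin (n + 1) => V) W}
    (h : ∀ α, ∀ a ∈ 𝒱 α, f.curryLeft a = g.curryLeft a) : f = g :=
  (multilinearCurryLeftEquiv k (fun _ : Fin (n + 1) => V) W).injective
    (linearMap_ext_of_homogeneous 𝒱 h)

section CurryLeft

variable {R : Type*} [CommRing R] {n : ℕ} {V : Fin (n + 1) → Type*} {W : Type*}
  [∀ s, AddCommGroup (V s)] [∀ s, Module R (V s)] [AddCommGroup W] [Module R W]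
  (f g : MultilinearMap R V W) (a : V 0)

theorem curryLeft_sub : (f - g).curryLeft a = f.curryLeft a - g.curryLeft a := rfl

theorem curryLeft_smul (c : R) : (c • f).curryLeft a = c • f.curryLeft a := rfl

end CurryLeft

theorem val_cons {Γ R V : Type*} [Semiring R] [AddCommMonoid V] [Module R V]
    {𝒱 : Γ → Submodule R V} {n : ℕ} (a : (α : Γ) × 𝒱 α) (e : Fin n → (α : Γ) × 𝒱 α) :
    (fun s => ((Fin.cons (α := fun _ => (α : Γ) × 𝒱 α) a e s).2 : V)) =
      Fin.cons (a.2 : V) fun s => ((e s).2 : V) :=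
  funext (Fin.cases rfl fun _ => rfl)

theorem multilinearMap_ext_of_tuples {Γ k V W : Type*} [DecidableEq Γ] [Field k]
    [AddCommGroup V] [Module k V] [AddCommGroup W] [Module k W]
    {𝒱 : Γ → Submodule k V} [DirectSum.Decomposition 𝒱] {n : ℕ}
    {f g : MultilinearMap k (fun _ : Fin n => V) W}
    (h : ∀ e : Fin n → (α : Γ) × 𝒱 α, f (fun s => (e s).2) = g (fun s => (e s).2)) : f = g :=
  multilinearMap_ext_of_homogeneous 𝒱 fun α x hx => h fun s => ⟨α s, x s, hx s⟩

section Lie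

variable {Γ k : Type*} [AddCommGroup Γ] [Field k] {ε : CommutationFactor Γ k}
variable {V W : Type*} [AddCommGroup V] [Module k V] [AddCommGroup W] [Module k W]
variable {𝒱 : Γ → Submodule k V} {𝒲 : Γ → Submodule k W}

theorem EpsLieAlgebra.leibniz (𝔤 : EpsLieAlgebra ε 𝒱) {α β γ : Γ} {x y z : V} (hx : x ∈ 𝒱 α)
    (hy : y ∈ 𝒱 β) (hz : z ∈ 𝒱 γ) : 𝔤.bracket (𝔤.bracket x y) z =
      𝔤.bracket x (𝔤.bracket y z) - ε α β • 𝔤.bracket y (𝔤.bracket x z) := by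
  have jacobi := 𝔤.jacobi hx hy hz
  have skew_zx := eq_neg_of_add_eq_zero_left (𝔤.skew hz hx)
  have skew_zxy := eq_neg_of_add_eq_zero_left (𝔤.skew hz (𝔤.bracket_mem hx hy))
  have swap_βγ := ε.mul_swap β γ
  simp only [skew_zx, skew_zxy, map_neg, map_smul, ε.add_right] at jacobi
  rw [← sub_eq_zero, ← smul_eq_zero_iff_right (neg_ne_zero.2 (left_ne_zero_of_mul_eq_one
    (ε.mul_swap γ α))), ← jacobi]
  match_scalars <;> grind

namespace EpsLieModule

variable [DecidableEq Γ] [DirectSum.Decomposition 𝒱] {𝔤 : EpsLieAlgebra ε 𝒱}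
  (𝔐 : EpsLieModule 𝔤 𝒲)

theorem actMap_sub {n : ℕ} (α β : Γ) (u : V) (f g : MultilinearMap k (fun _ : Fin n => V) W) :
    𝔐.actMap α β u (f - g) = 𝔐.actMap α β u f - 𝔐.actMap α β u g := by
  refine multilinearMap_ext_of_homogeneous 𝒱 fun γ x hx => ?_
  simp only [sub_apply, 𝔐.actMap_apply α β _ _ hx, map_sub, smul_sub, Finset.sum_sub_distrib]
  abel

theorem actMap_smul {n : ℕ} (α β : Γ) (u : V) (c : k)
    (f : MultilinearMap k (fun _ : Fin n => V) W) :
    𝔐.actMap α β u (c • f) = c • 𝔐.actMap α β u f := by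
  refine multilinearMap_ext_of_homogeneous 𝒱 fun γ x hx => ?_
  simp only [smul_apply, 𝔐.actMap_apply α β _ _ hx, map_smul, smul_comm _ c,
    ← Finset.smul_sum, ← smul_sub]

theorem coboundMap_sub {n : ℕ} (β : Γ) (f g : MultilinearMap k (fun _ : Fin n => V) W) :
    𝔐.coboundMap β (f - g) = 𝔐.coboundMap β f - 𝔐.coboundMap β g := by
  refine multilinearMap_ext_of_homogeneous 𝒱 fun α x hx => ?_
  simp only [sub_apply, 𝔐.coboundMap_apply β _ hx, map_sub, smul_sub, Finset.sum_sub_distrib]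
  abel

theorem coboundMap_smul {n : ℕ} (β : Γ) (c : k) (f : MultilinearMap k (fun _ : Fin n => V) W) :
    𝔐.coboundMap β (c • f) = c • 𝔐.coboundMap β f := by
  refine multilinearMap_ext_of_homogeneous 𝒱 fun α x hx => ?_
  simp only [smul_apply, 𝔐.coboundMap_apply β _ hx, map_smul, smul_comm _ c,
    ← Finset.smul_sum, ← smul_sub]

theorem actMap_eq_tuple {n : ℕ} (β : Γ) (u : (α : Γ) × 𝒱 α)
    (f : MultilinearMap k (fun _ : Fin n => V) W) (e : Fin n → (α : Γ) × 𝒱 α) :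
    𝔐.actMap u.1 β u.2 f (fun s => (e s).2) = 𝔐.act u.2 (f fun s => (e s).2) -
      ε u.1 β • tupleAct ε Sigma.fst 𝔤.brHom u (fun y => f fun s => (y s).2) e := by
  rw [𝔐.actMap_apply u.1 β u.2 f fun s => (e s).2.2]
  simp only [tupleAct, val_update, EpsLieAlgebra.brHom, ε.add_right, Finset.smul_sum, smul_smul]

theorem curryLeft_actMap {n : ℕ} {α β δ : Γ} {u a : V} (hu : u ∈ 𝒱 α) (ha : a ∈ 𝒱 δ)
    (f : MultilinearMap k (fun _ : Fin (n + 1) => V) W) :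
    (𝔐.actMap α β u f).curryLeft a =
      𝔐.actMap α (β + δ) u (f.curryLeft a) - ε α β • f.curryLeft (𝔤.bracket u a) := by
  refine multilinearMap_ext_of_tuples (𝒱 := 𝒱) fun e => ?_
  have whole := 𝔐.actMap_eq_tuple β ⟨α, u, hu⟩ f (Fin.cons ⟨δ, a, ha⟩ e)
  have contracted := 𝔐.actMap_eq_tuple (β + δ) ⟨α, u, hu⟩ (f.curryLeft a) e
  simp only [tupleAct_cons, val_cons, MultilinearMap.curryLeft_apply] at whole contracted
  simp only [MultilinearMap.curryLeft_apply, sub_apply, smul_apply, whole, contracted,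
    EpsLieAlgebra.brHom, ε.add_right]
  module

theorem curryLeft_coboundMap_zero {β δ : Γ} {a : V} (ha : a ∈ 𝒱 δ)
    (f : MultilinearMap k (fun _ : Fin 0 => V) W) :
    (𝔐.coboundMap β f).curryLeft a = ε β δ • 𝔐.actMap δ β a f := by
  refine multilinearMap_ext_of_tuples (𝒱 := 𝒱) fun e => ?_
  have whole := 𝔐.coboundMap_eq_tuple β f (Fin.cons ⟨δ, a, ha⟩ e)
  have acted := 𝔐.actMap_eq_tuple β ⟨δ, a, ha⟩ f e
  simp only [tupleCobound_zero, val_cons] at whole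
  simp only [MultilinearMap.curryLeft_apply, smul_apply, whole, acted]
  simp [tupleAct]

theorem curryLeft_coboundMap_succ {n : ℕ} {β δ : Γ} {a : V} (ha : a ∈ 𝒱 δ)
    (f : MultilinearMap k (fun _ : Fin (n + 1) => V) W) :
    (𝔐.coboundMap β f).curryLeft a =
      ε β δ • 𝔐.actMap δ β a f - 𝔐.coboundMap (β + δ) (f.curryLeft a) := by
  refine multilinearMap_ext_of_tuples (𝒱 := 𝒱) fun e => ?_
  have whole := 𝔐.coboundMap_eq_tuple β f (Fin.cons ⟨δ, a, ha⟩ e)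
  have acted := 𝔐.actMap_eq_tuple β ⟨δ, a, ha⟩ f e
  have contracted := 𝔐.coboundMap_eq_tuple (β + δ) (f.curryLeft a) e
  simp only [tupleCobound_cons, val_cons, MultilinearMap.curryLeft_apply] at whole contracted
  simp only [MultilinearMap.curryLeft_apply, sub_apply, smul_apply, whole, acted, contracted,
    smul_sub, smul_smul, ε.mul_swap, one_smul]

theorem actMap_bracket {n : ℕ} {α β γ : Γ} {u v : V} (hu : u ∈ 𝒱 α) (hv : v ∈ 𝒱 β)
    (f : MultilinearMap k (fun _ : Fin n => V) W) :
    𝔐.actMap (α + β) γ (𝔤.bracket u v) f =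
      𝔐.actMap α (β + γ) u (𝔐.actMap β γ v f) -
        ε α β • 𝔐.actMap β (α + γ) v (𝔐.actMap α γ u f) := by
  induction n generalizing γ with
  | zero =>
    refine multilinearMap_ext_of_homogeneous 𝒱 fun δ x hx => ?_
    simp only [sub_apply, smul_apply, 𝔐.actMap_apply _ _ _ _ hx, Finset.univ_eq_empty,
      Finset.sum_empty, sub_zero]
    exact 𝔐.isModule.act_bracket hu hv _
  | succ n ih =>
    refine multilinearMap_ext_of_curryLeft 𝒱 fun δ a ha => ?_
    have swap_αβ := ε.mul_swap α β
    simp only [curryLeft_sub, curryLeft_smul, 𝔐.curryLeft_actMap hu ha, 𝔐.curryLeft_actMap hv ha,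
      𝔐.curryLeft_actMap (𝔤.bracket_mem hu hv) ha, 𝔐.curryLeft_actMap hu (𝔤.bracket_mem hv ha),
      𝔐.curryLeft_actMap hv (𝔤.bracket_mem hu ha),
      𝔐.actMap_sub, 𝔐.actMap_smul, ih, 𝔤.leibniz hu hv ha, map_sub, map_smul]
    simp only [ε.add_left, ε.add_right, add_comm, add_left_comm]
    match_scalars <;> grind

theorem actMap_coboundMap {n : ℕ} {α β : Γ} {u : V} (hu : u ∈ 𝒱 α)
    (f : MultilinearMap k (fun _ : Fin n => V) W) :
    𝔐.actMap α β u (𝔐.coboundMap β f) = 𝔐.coboundMap (α + β) (𝔐.actMap α β u f) := by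
  induction n generalizing β with
  | zero =>
    refine multilinearMap_ext_of_curryLeft 𝒱 fun δ a ha => ?_
    have swap_αβ := ε.mul_swap α β
    simp only [𝔐.curryLeft_actMap hu ha, 𝔐.curryLeft_coboundMap_zero ha,
      𝔐.curryLeft_coboundMap_zero (𝔤.bracket_mem hu ha), 𝔐.actMap_smul,
      𝔐.actMap_bracket hu ha, ε.add_left, ε.add_right, add_comm]
    match_scalars <;> grind
  | succ n ih =>
    refine multilinearMap_ext_of_curryLeft 𝒱 fun δ a ha => ?_
    have swap_αβ := ε.mul_swap α β
    simp only [𝔐.curryLeft_actMap hu ha, 𝔐.curryLeft_coboundMap_succ ha,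
      𝔐.curryLeft_coboundMap_succ (𝔤.bracket_mem hu ha), 𝔐.actMap_smul, 𝔐.actMap_sub,
      𝔐.coboundMap_sub, 𝔐.coboundMap_smul, ih, 𝔐.actMap_bracket hu ha]
    simp only [ε.add_left, ε.add_right, add_comm, add_left_comm]
    match_scalars <;> grind

theorem coboundMap_coboundMap {n : ℕ} (β : Γ) (f : MultilinearMap k (fun _ : Fin n => V) W) :
    𝔐.coboundMap β (𝔐.coboundMap β f) = 0 := by
  induction n generalizing β with
  | zero =>
    refine multilinearMap_ext_of_curryLeft 𝒱 fun δ a ha => ?_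
    rw [𝔐.curryLeft_coboundMap_succ ha, 𝔐.curryLeft_coboundMap_zero ha, 𝔐.coboundMap_smul,
      𝔐.actMap_coboundMap ha, add_comm δ β, sub_self]
    rfl
  | succ n ih =>
    refine multilinearMap_ext_of_curryLeft 𝒱 fun δ a ha => ?_
    rw [𝔐.curryLeft_coboundMap_succ ha, 𝔐.curryLeft_coboundMap_succ ha, 𝔐.coboundMap_sub,
      𝔐.coboundMap_smul, ih, 𝔐.actMap_coboundMap ha, add_comm δ β, sub_zero, sub_self]
    rfl

theorem d_comp_d (n : ℕ) : 𝔐.d (n + 1) ∘ₗ 𝔐.d n = 0 := by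
  refine DirectSum.linearMap_ext k fun β => LinearMap.ext fun f => ?_
  have square_zero : 𝔐.dDeg (n + 1) β (𝔐.dDeg n β f) = 0 :=
    CochainSpace.ext (𝔐.coboundMap_coboundMap β f.map)
  simp only [LinearMap.comp_apply, d, DirectSum.lmap_lof, square_zero, map_zero,
    LinearMap.zero_apply]

end EpsLieModule

theorem EpsLieAlgebra.isModule_totalAct [DecidableEq Γ] [DirectSum.Decomposition 𝒱]
    (𝔤 : EpsLieAlgebra ε 𝒱) {C : Γ → Type*} [∀ β, AddCommGroup (C β)] [∀ β, Module k (C β)]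
    {φ : ∀ α β, 𝒱 α →ₗ[k] C β →ₗ[k] C (α + β)}
    (act_bracket : ∀ {α β γ : Γ} (x : 𝒱 α) (y : 𝒱 β) (f : C γ),
      DirectSum.lof k Γ C (α + β + γ)
          (φ (α + β) γ ⟨𝔤.bracket x y, 𝔤.bracket_mem x.2 y.2⟩ f) =
        DirectSum.lof k Γ C (α + (β + γ)) (φ α (β + γ) x (φ β γ y f)) -
          ε α β • DirectSum.lof k Γ C (β + (α + γ)) (φ β (α + γ) y (φ α γ x f))) :
    𝔤.IsModule (totalDeg k C) (totalAct 𝒱 φ) where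
  act_mem := by
    rintro α β x _ hx ⟨f, rfl⟩
    exact ⟨_, (totalAct_lof 𝒱 φ ⟨x, hx⟩ f).symm⟩
  act_bracket {α β x y} hx hy f := by
    refine LinearMap.congr_fun (f := totalAct 𝒱 φ (𝔤.bracket x y))
      (g := totalAct 𝒱 φ x ∘ₗ totalAct 𝒱 φ y - ε α β • totalAct 𝒱 φ y ∘ₗ totalAct 𝒱 φ x)
      (DirectSum.linearMap_ext k fun γ => LinearMap.ext fun f => ?_) f
    lift x to 𝒱 α using hx
    lift y to 𝒱 β using hy
    have bracket_lof := totalAct_lof 𝒱 φ ⟨𝔤.bracket x y, 𝔤.bracket_mem x.2 y.2⟩ f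
    simp only [LinearMap.comp_apply, LinearMap.sub_apply, LinearMap.smul_apply, totalAct_lof,
      bracket_lof, act_bracket]

theorem CochainSpace.lof_eq_lof_sub_smul_lof [DecidableEq Γ] {n m : ℕ} {β β₁ β₂ : Γ} (c : k)
    {f : CochainSpace ε 𝒱 𝒲 n m β} {f₁ : CochainSpace ε 𝒱 𝒲 n m β₁}
    {f₂ : CochainSpace ε 𝒱 𝒲 n m β₂} (h₁ : β₁ = β) (h₂ : β₂ = β)
    (hf : f.map = f₁.map - c • f₂.map) :
    DirectSum.lof k Γ (CochainSpace ε 𝒱 𝒲 n m) β f =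
      DirectSum.lof k Γ (CochainSpace ε 𝒱 𝒲 n m) β₁ f₁ -
        c • DirectSum.lof k Γ (CochainSpace ε 𝒱 𝒲 n m) β₂ f₂ := by
  subst h₁ h₂
  have f_eq : f = f₁ - c • f₂ := CochainSpace.ext hf
  rw [f_eq, map_sub, LinearMap.map_smul]

theorem EpsLieModule.cochainAct_isModule [DecidableEq Γ] [DirectSum.Decomposition 𝒱]
    {𝔤 : EpsLieAlgebra ε 𝒱} (𝔐 : EpsLieModule 𝔤 𝒲) (n : ℕ) :
    𝔤.IsModule (𝔐.cochainDeg n) (𝔐.cochainAct n) :=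
  𝔤.isModule_totalAct fun {α β γ} x y f =>
    CochainSpace.lof_eq_lof_sub_smul_lof (ε α β) (add_assoc α β γ).symm
      (by rw [add_left_comm, add_assoc]) (𝔐.actMap_bracket x.2 y.2 f.map)

theorem EpsLieAlgebra.IsModule.of_surjective {𝔤 : EpsLieAlgebra ε 𝒱} {act : V →ₗ[k] W →ₗ[k] W}
    (h : 𝔤.IsModule 𝒲 act) {W' : Type*} [AddCommGroup W'] [Module k W']
    {act' : V →ₗ[k] W' →ₗ[k] W'} {L : W →ₗ[k] W'} (hL : Function.Surjective L)
    (comm : ∀ x w, L (act x w) = act' x (L w)) :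
    𝔤.IsModule (fun γ => (𝒲 γ).map L) act' where
  act_mem := by
    rintro α β x _ hx ⟨w, hw, rfl⟩
    exact ⟨act x w, h.act_mem hx hw, comm x w⟩
  act_bracket {α β x y} hx hy := by
    refine hL.forall.2 fun w => ?_
    simp only [← comm, h.act_bracket hx hy, map_sub, map_smul]

end Lie

section Tuples

variable {Γ k : Type*} [AddCommGroup Γ] [Field k] {ε : CommutationFactor Γ k}
variable {E W W' : Type*} [AddCommGroup W] [Module k W] [AddCommGroup W'] [Module k W']
variable {deg : E → Γ} {br : E → E → E} {n : ℕ} (L : W →ₗ[k] W') (F : (Fin n → E) → W)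

theorem map_tupleAct (u : E) (y : Fin n → E) :
    L (tupleAct ε deg br u F y) = tupleAct ε deg br u (fun y => L (F y)) y := by
  simp only [tupleAct, map_sum, map_smul]

theorem map_tupleCobound (β : Γ) (P : E → (Fin n → E) → W) (y : Fin (n + 1) → E) :
    L (tupleCobound ε deg br β P F y) =
      tupleCobound ε deg br β (fun u y => L (P u y)) (fun y => L (F y)) y := by
  simp only [tupleCobound, map_sum, map_smul, map_sub]

end Tuples

section Snoc

variable {Γ : Type*} {n : ℕ}

theorem snoc_mem {R S : Type*} [Semiring R] [AddCommMonoid S] [Module R S]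
    {𝒮 : Γ → Submodule R S} {x : Fin n → S} {α : Fin n → Γ} (hx : ∀ s, x s ∈ 𝒮 (α s))
    {z : S} {δ : Γ} (hz : z ∈ 𝒮 δ) (s : Fin (n + 1)) :
    (Fin.snoc (α := fun _ => S) x z : Fin (n + 1) → S) s ∈
      𝒮 ((Fin.snoc (α := fun _ => Γ) α δ : Fin (n + 1) → Γ) s) := by
  cases s using Fin.lastCases with
  | last => simpa only [Fin.snoc_last] using hz
  | cast s => simpa only [Fin.snoc_castSucc] using hx s

theorem sum_snoc_lt_castSucc [AddCommMonoid Γ] (α : Fin n → Γ) (δ : Γ) (t : Fin n) :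
    ∑ s with s < t.castSucc, (Fin.snoc (α := fun _ => Γ) α δ : Fin (n + 1) → Γ) s =
      ∑ s with s < t, α s := by
  simp [Finset.sum_filter, Fin.sum_univ_castSucc, Fin.not_lt.2 (Fin.le_last _)]

theorem sum_snoc_lt_last [AddCommMonoid Γ] (α : Fin n → Γ) (δ : Γ) :
    ∑ s with s < Fin.last n, (Fin.snoc (α := fun _ => Γ) α δ : Fin (n + 1) → Γ) s =
      ∑ s, α s := by
  simp [Finset.sum_filter, Fin.sum_univ_castSucc, Fin.castSucc_lt_last]

theorem multilinearMap_ext_of_snoc_tuples {k S M : Type*} [DecidableEq Γ] [Field k]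
    [AddCommGroup S] [Module k S] [AddCommGroup M] [Module k M]
    {𝒮 : Γ → Submodule k S} [DirectSum.Decomposition 𝒮]
    {f g : MultilinearMap k (fun _ : Fin (n + 1) => S) M}
    (h : ∀ (e : Fin n → (α : Γ) × 𝒮 α) (z : (α : Γ) × 𝒮 α),
      f (Fin.snoc (α := fun _ => S) (fun s => ((e s).2 : S)) z.2) =
        g (Fin.snoc (α := fun _ => S) (fun s => ((e s).2 : S)) z.2)) : f = g :=
  (multilinearCurryRightEquiv k (fun _ : Fin (n + 1) => S) M).injective <|
    multilinearMap_ext_of_tuples (𝒱 := 𝒮) fun e =>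
      linearMap_ext_of_homogeneous 𝒮 fun γ z hz => h e ⟨γ, z, hz⟩

end Snoc

section Subquotients

variable {R X X' Y Y' : Type*} [Ring R] [AddCommGroup X] [Module R X] [AddCommGroup X']
  [Module R X'] [AddCommGroup Y] [Module R Y] [AddCommGroup Y'] [Module R Y']

theorem map_ker_eq_ker {d : X →ₗ[R] Y} {d' : X' →ₗ[R] Y'} {e : X ≃ₗ[R] X'} {e' : Y ≃ₗ[R] Y'}
    (comm : e'.toLinearMap ∘ₗ d = d' ∘ₗ e.toLinearMap) :
    (LinearMap.ker d).map e.toLinearMap = LinearMap.ker d' := by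
  rw [← LinearEquiv.ker_comp e' d, comm, LinearMap.ker_comp,
    Submodule.map_comap_eq_of_surjective e.surjective]

theorem map_range_eq_range {d : X →ₗ[R] Y} {d' : X' →ₗ[R] Y'} {e : X ≃ₗ[R] X'} {e' : Y ≃ₗ[R] Y'}
    (comm : e'.toLinearMap ∘ₗ d = d' ∘ₗ e.toLinearMap) :
    (LinearMap.range d).map e'.toLinearMap = LinearMap.range d' := by
  rw [← LinearMap.range_comp, comm, LinearEquiv.range_comp]

/-- The isomorphism `Z / (B ∩ Z) ≃ Z' / (B' ∩ Z')` induced by a linear equivalence that carries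
`Z` to `Z'` and `B` to `B'`; it sends the class of `z` to the class of `e z`. -/
def subquotientEquiv (e : X ≃ₗ[R] X') {Z B : Submodule R X} {Z' B' : Submodule R X'}
    (hZ : Z.map e.toLinearMap = Z') (hB : B.map e.toLinearMap = B') :
    (Z ⧸ B.submoduleOf Z) ≃ₗ[R] Z' ⧸ B'.submoduleOf Z' :=
  Submodule.Quotient.equiv _ _ (e.ofSubmodules Z Z' hZ) <| by
    subst hB
    ext z'
    obtain ⟨z, rfl⟩ := (e.ofSubmodules Z Z' hZ).surjective z'
    simp [Submodule.submoduleOf]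

end Subquotients

namespace Bimodule

variable {Γ k : Type*} [AddCommGroup Γ] [DecidableEq Γ] [Field k] {ε : CommutationFactor Γ k}
variable {S M : Type*} [AddCommGroup S] [Module k S] [AddCommGroup M] [Module k M]
variable {𝒮 : Γ → Submodule k S} [DirectSum.Decomposition 𝒮] {ℳ : Γ → Submodule k M}

theorem curryRight_mem {i : ℕ} {β : Γ} {g : MultilinearMap k (fun _ : Fin (i + 1) => S) M}
    (hg : g ∈ cochains ε 𝒮 ℳ (i + 1) i β) :
    g.curryRight ∈ cochains ε 𝒮 (homDeg 𝒮 ℳ) i i β := by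
  intro α x hx
  constructor
  · intro δ z hz
    have degree := (hg _ _ (snoc_mem hx hz)).1
    simpa [Fin.sum_univ_castSucc, add_assoc] using degree
  · intro p q hpq _
    exact linearMap_ext_of_homogeneous 𝒮 fun δ z hz =>
      tupleSkew_of_mem hg ⟨δ, z, hz⟩ (fun s => ⟨α s, x s, hx s⟩) p q hpq

theorem psiDeg_bijective (i : ℕ) (β : Γ) :
    Function.Bijective (psiDeg (ε := ε) (𝒮 := 𝒮) (ℳ := ℳ) i β) :=
  Function.bijective_iff_has_inverse.2
    ⟨fun g => .mk g.map.curryRight (curryRight_mem g.map_mem),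
      fun f => CochainSpace.ext
        (MultilinearMap.curry_uncurryRight (M := fun _ : Fin (i + 1) => S) f.map),
      fun g => CochainSpace.ext (MultilinearMap.uncurry_curryRight g.map)⟩

variable {A : LeftSymmetricAlgebra ε 𝒮} (B : Bimodule A ℳ)

theorem actMap_eq_tuple {i : ℕ} (β : Γ) (u : (α : Γ) × 𝒮 α)
    (f : MultilinearMap k (fun _ : Fin (i + 1) => S) M) (e : Fin i → (α : Γ) × 𝒮 α)
    (z : (α : Γ) × 𝒮 α) :
    B.actMap u.1 β u.2 f (Fin.snoc (α := fun _ => S) (fun s => ((e s).2 : S)) z.2) =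
      B.left u.2 (f (Fin.snoc (α := fun _ => S) (fun s => ((e s).2 : S)) z.2)) -
      ε u.1 (β + ∑ s, (e s).1) •
        (f (Fin.snoc (α := fun _ => S) (fun s => ((e s).2 : S)) (A.mul u.2 z.2)) -
        B.right (f (Fin.snoc (α := fun _ => S) (fun s => ((e s).2 : S)) u.2)) z.2) -
      ε u.1 β • tupleAct ε Sigma.fst A.lie.brHom u
        (fun y => f (Fin.snoc (α := fun _ => S) (fun s => ((y s).2 : S)) z.2)) e := by
  rw [B.actMap_apply u.1 β u.2 f (snoc_mem (fun s => (e s).2.2) z.2.2)]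
  simp only [sum_snoc_lt_castSucc, sum_snoc_lt_last, tupleAct, val_update, ε.add_right,
    Finset.smul_sum, smul_smul, Fin.snoc_castSucc, Fin.snoc_last, Fin.update_snoc_last,
    ← Fin.snoc_update, EpsLieAlgebra.brHom]
  module

variable [DirectSum.Decomposition ℳ] [FiniteDimensional k S] [FiniteDimensional k M]

theorem homModule_act_cochain_apply {i : ℕ} {β : Γ}
    {f : MultilinearMap k (fun _ : Fin i => S) (S →ₗ[k] M)}
    (hf : f ∈ cochains ε 𝒮 (homDeg 𝒮 ℳ) i i β) (u z : (α : Γ) × 𝒮 α)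
    (e : Fin i → (α : Γ) × 𝒮 α) :
    B.homModule.act u.2 (f fun s => (e s).2) z.2 =
      B.left u.2 (f (fun s => (e s).2) z.2) - ε u.1 (β + ∑ s, (e s).1) •
        (f (fun s => (e s).2) (A.mul u.2 z.2) - B.right (f (fun s => (e s).2) u.2) z.2) := by
  have degree := (hf (fun s => (e s).1) (fun s => (e s).2) fun s => (e s).2.2).1
  refine (B.homAct_apply u.2.2 degree z.2).trans ?_
  module

theorem uncurryRight_coboundMap {i : ℕ} {β : Γ}
    {f : MultilinearMap k (fun _ : Fin i => S) (S →ₗ[k] M)}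
    (hf : f ∈ cochains ε 𝒮 (homDeg 𝒮 ℳ) i i β) :
    MultilinearMap.uncurryRight (M := fun _ : Fin (i + 1 + 1) => S) (B.homModule.coboundMap β f) =
      B.coboundMap β (MultilinearMap.uncurryRight (M := fun _ : Fin (i + 1) => S) f) := by
  refine multilinearMap_ext_of_snoc_tuples (𝒮 := 𝒮) fun e z => ?_
  rw [B.coboundMap_eq_tuple]
  simp only [MultilinearMap.uncurryRight_apply, Fin.init_snoc, Fin.snoc_last]
  rw [B.homModule.coboundMap_eq_tuple]
  refine (map_tupleCobound (LinearMap.applyₗ (z.2 : S)) _ _ _ _).trans ?_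
  simp only [LinearMap.applyₗ_apply_apply, B.homModule_act_cochain_apply hf]

theorem uncurryRight_actMap {i : ℕ} {α β : Γ} {u : S} (hu : u ∈ 𝒮 α)
    {f : MultilinearMap k (fun _ : Fin i => S) (S →ₗ[k] M)}
    (hf : f ∈ cochains ε 𝒮 (homDeg 𝒮 ℳ) i i β) :
    MultilinearMap.uncurryRight (M := fun _ : Fin (i + 1) => S) (B.homModule.actMap α β u f) =
      B.actMap α β u (MultilinearMap.uncurryRight (M := fun _ : Fin (i + 1) => S) f) := by
  refine multilinearMap_ext_of_snoc_tuples (𝒮 := 𝒮) fun e z => ?_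
  have in_M := B.actMap_eq_tuple β ⟨α, u, hu⟩
    (MultilinearMap.uncurryRight (M := fun _ : Fin (i + 1) => S) f) e z
  have in_Hom := congrArg (LinearMap.applyₗ (z.2 : S))
    (B.homModule.actMap_eq_tuple β ⟨α, u, hu⟩ f e)
  rw [map_sub, map_smul, map_tupleAct] at in_Hom
  simp only [MultilinearMap.uncurryRight_apply, Fin.init_snoc, Fin.snoc_last,
    LinearMap.applyₗ_apply_apply, B.homModule_act_cochain_apply hf ⟨α, u, hu⟩] at in_M in_Hom ⊢
  rw [in_M, in_Hom]

theorem psi_comp_d (i : ℕ) : B.psi (i + 1) ∘ₗ B.homModule.d i = B.d i ∘ₗ B.psi i := by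
  refine DirectSum.linearMap_ext k fun β => LinearMap.ext fun f => ?_
  simp only [LinearMap.comp_apply, d, psi, EpsLieModule.d, DirectSum.lmap_lof]
  exact congrArg _ (CochainSpace.ext (B.uncurryRight_coboundMap f.map_mem))

theorem psi_cochainAct (i : ℕ) (x : S) (f : B.homModule.Cochain i) :
    B.psi i (B.homModule.cochainAct i x f) = B.cochainAct i x (B.psi i f) := by
  suffices h : (B.homModule.cochainAct i).compr₂ (B.psi i) =
      (B.cochainAct i).compl₂ (B.psi i) from LinearMap.congr_fun (LinearMap.congr_fun h x) f
  refine linearMap_ext_of_homogeneous 𝒮 fun α x hx =>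
    DirectSum.linearMap_ext k fun β => LinearMap.ext fun f => ?_
  lift x to 𝒮 α using hx
  simp only [LinearMap.comp_apply, LinearMap.compr₂_apply, LinearMap.compl₂_apply, cochainAct,
    EpsLieModule.cochainAct, psi, totalAct_lof, DirectSum.lmap_lof]
  exact congrArg _ (CochainSpace.ext (B.uncurryRight_actMap x.2 f.map_mem))

theorem psi_bijective (i : ℕ) : Function.Bijective (B.psi i) :=
  ⟨(DirectSum.lmap_injective _).2 fun β => (psiDeg_bijective i β).1,
    (DirectSum.lmap_surjective _).2 fun β => (psiDeg_bijective i β).2⟩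

theorem map_psi_cochainDeg (i : ℕ) (γ : Γ) :
    (B.homModule.cochainDeg i γ).map (B.psi i) = B.cochainDeg i γ := by
  have psi_comp_lof : B.psi i ∘ₗ DirectSum.lof k Γ _ γ =
      DirectSum.lof k Γ _ γ ∘ₗ psiDeg (ε := ε) (𝒮 := 𝒮) (ℳ := ℳ) i γ :=
    LinearMap.ext fun f => DirectSum.lmap_lof _ _ _
  rw [cochainDeg, EpsLieModule.cochainDeg, totalDeg, totalDeg, ← LinearMap.range_comp,
    psi_comp_lof, LinearMap.range_comp, LinearMap.range_eq_top.2 (psiDeg_bijective i γ).2,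
    Submodule.map_top]

theorem cochainAct_isModule (i : ℕ) : A.lie.IsModule (B.cochainDeg i) (B.cochainAct i) := by
  simpa only [B.map_psi_cochainDeg] using (B.homModule.cochainAct_isModule i).of_surjective
    (B.psi_bijective i).2 (B.psi_cochainAct i)

theorem d_comp_d (i : ℕ) : B.d (i + 1) ∘ₗ B.d i = 0 := by
  rw [← LinearMap.cancel_right (B.psi_bijective i).2, LinearMap.comp_assoc, ← B.psi_comp_d,
    ← LinearMap.comp_assoc, ← B.psi_comp_d, LinearMap.comp_assoc, B.homModule.d_comp_d,
    LinearMap.comp_zero, LinearMap.zero_comp]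

/-- `ψ` as a linear equivalence. -/
noncomputable def psiEquiv (i : ℕ) : B.homModule.Cochain i ≃ₗ[k] B.Cochain i :=
  LinearEquiv.ofBijective (B.psi i) (B.psi_bijective i)

theorem map_psi_cocycles (i : ℕ) :
    (B.homModule.cocycles i).map (B.psiEquiv i).toLinearMap = B.cocycles i :=
  map_ker_eq_ker (e := B.psiEquiv i) (e' := B.psiEquiv (i + 1)) (B.psi_comp_d i)

theorem map_psi_coboundaries (i : ℕ) :
    (B.homModule.coboundaries (i + 1)).map (B.psiEquiv (i + 1)).toLinearMap =
      B.coboundaries (i + 1) :=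
  map_range_eq_range (e := B.psiEquiv i) (e' := B.psiEquiv (i + 1)) (B.psi_comp_d i)

/-- The isomorphism `H^{i+1}_Lie(𝔤_S, C¹(S, M)) ≅ H^{i+2}(S, M)` induced by `ψ`. -/
noncomputable def psiCohomology (i : ℕ) :
    B.homModule.Cohomology (i + 1) ≃ₗ[k] B.Cohomology (i + 1) :=
  subquotientEquiv (B.psiEquiv (i + 1)) (B.map_psi_cocycles (i + 1)) (B.map_psi_coboundaries i)

end Bimodule

end GLSA

theorem theorem4p1_general {Γ k : Type*} [AddCommGroup Γ] [DecidableEq Γ] [Field k]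
    (ε : GLSA.CommutationFactor Γ k)
    {S M : Type*} [AddCommGroup S] [Module k S] [FiniteDimensional k S]
    [AddCommGroup M] [Module k M] [FiniteDimensional k M]
    (𝒮 : Γ → Submodule k S) [DirectSum.Decomposition 𝒮]
    (ℳ : Γ → Submodule k M) [DirectSum.Decomposition ℳ]
    (A : GLSA.LeftSymmetricAlgebra ε 𝒮) (B : GLSA.Bimodule A ℳ) :
    (∀ i : ℕ,
      A.lie.IsModule (B.homModule.cochainDeg i) (B.homModule.cochainAct i) ∧
      A.lie.IsModule (B.cochainDeg i) (B.cochainAct i) ∧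
      Function.Bijective (B.psi i) ∧
      (∀ γ : Γ, (B.homModule.cochainDeg i γ).map (B.psi i) = B.cochainDeg i γ) ∧
      ∀ (x : S) (f : B.homModule.Cochain i),
        B.psi i (B.homModule.cochainAct i x f) = B.cochainAct i x (B.psi i f)) ∧
    (∀ i : ℕ,
      (∀ f : B.homModule.Cochain i, B.homModule.d (i + 1) (B.homModule.d i f) = 0) ∧
      (∀ g : B.Cochain i, B.d (i + 1) (B.d i g) = 0) ∧
      ∀ f : B.homModule.Cochain i, B.psi (i + 1) (B.homModule.d i f) = B.d i (B.psi i f)) ∧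
    (∀ i : ℕ, 0 < i → ∃ Φ : B.homModule.Cohomology i ≃ₗ[k] B.Cohomology i,
      ∀ z : B.homModule.cocycles i, ∃ hz : B.psi i z ∈ B.cocycles i,
        Φ (Submodule.Quotient.mk z) = Submodule.Quotient.mk ⟨B.psi i z, hz⟩) :=
  ⟨fun i => ⟨B.homModule.cochainAct_isModule i, B.cochainAct_isModule i, B.psi_bijective i,
      B.map_psi_cochainDeg i, B.psi_cochainAct i⟩,
    fun i => ⟨LinearMap.congr_fun (B.homModule.d_comp_d i), LinearMap.congr_fun (B.d_comp_d i),
      LinearMap.congr_fun (B.psi_comp_d i)⟩,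
    fun i hi => by
      obtain ⟨i, rfl⟩ := Nat.exists_eq_succ_of_ne_zero hi.ne'
      exact ⟨B.psiCohomology i, fun z =>
        ⟨(B.map_psi_cocycles (i + 1)).le ⟨z, z.2, rfl⟩, rfl⟩⟩⟩

theorem theorem4p1 {Γ k : Type*} [AddCommGroup Γ] [DecidableEq Γ] [Field k] [CharZero k]
    (ε : GLSA.CommutationFactor Γ k)
    {S M : Type*} [AddCommGroup S] [Module k S] [FiniteDimensional k S]
    [AddCommGroup M] [Module k M] [FiniteDimensional k M]
    (𝒮 : Γ → Submodule k S) [DirectSum.Decomposition 𝒮]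
    (ℳ : Γ → Submodule k M) [DirectSum.Decomposition ℳ]
    (A : GLSA.LeftSymmetricAlgebra ε 𝒮) (B : GLSA.Bimodule A ℳ) :
    -- `ψ` is an isomorphism of `𝔤_S`-modules
    (∀ i : ℕ,
      A.lie.IsModule (B.homModule.cochainDeg i) (B.homModule.cochainAct i) ∧
      A.lie.IsModule (B.cochainDeg i) (B.cochainAct i) ∧
      Function.Bijective (B.psi i) ∧
      (∀ γ : Γ, (B.homModule.cochainDeg i γ).map (B.psi i) = B.cochainDeg i γ) ∧
      ∀ (x : S) (f : B.homModule.Cochain i),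
        B.psi i (B.homModule.cochainAct i x f) = B.cochainAct i x (B.psi i f)) ∧
    -- `ψ` is an isomorphism of cochain complexes
    (∀ i : ℕ,
      (∀ f : B.homModule.Cochain i, B.homModule.d (i + 1) (B.homModule.d i f) = 0) ∧
      (∀ g : B.Cochain i, B.d (i + 1) (B.d i g) = 0) ∧
      ∀ f : B.homModule.Cochain i, B.psi (i + 1) (B.homModule.d i f) = B.d i (B.psi i f)) ∧
    -- `ψ` induces isomorphisms `H^i_Lie(𝔤_S, C¹(S, M)) ≅ H^{i+1}(S, M)` for `i > 0`
    (∀ i : ℕ, 0 < i → ∃ Φ : B.homModule.Cohomology i ≃ₗ[k] B.Cohomology i,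
      ∀ z : B.homModule.cocycles i, ∃ hz : B.psi i z ∈ B.cocycles i,
        Φ (Submodule.Quotient.mk z) = Submodule.Quotient.mk ⟨B.psi i z, hz⟩) :=
  theorem4p1_general ε 𝒮 ℳ A B
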